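/- Notation. $B$ is the closed Euclidean unit ball of $\mathbb R^d$, $\mathcal E_A=\{x\in\mathbb R^d:\|Ax\|\le 1\}$ for a non-singular $A\in\mathbb R^{d\times d}$, and the circumradius $R(Z)$ is the least radius of a ball containing $Z$. Logarithms are natural. A streaming rounding algorithm is given $c_0\in\mathbb R^d$ and $r_0>0$, receives points $z_1,z_2,\dots\in\mathbb R^d$ one at a time, without knowing in advance how many there will be, and maintains after $t$ points an ellipsoid $\mathcal E_t=\mathcal E_{A_t}$, a center $c_t$ and a scaling factor $\alpha_t\in(0,1]$, with $c_0+\mathcal E_0=c_0+r_0B$ and $\alpha_0=1$. It is monotone if for every stream and every $t\ge 1$ $$\operatorname{conv}\big((c_{t-1}+\mathcal E_{t-1})\cup\{z_t\}\big)\subseteq c_t+\mathcal E_t,\qquad c_t+\alpha_t\mathcal E_t\subseteq\operatorname{conv}\big((c_{t-1}+\alpha_{t-1}\mathcal E_{t-1})\cup\{z_t\}\big).$$ Full update of $(A,c,\alpha)$ with a point $z$. Let $u=A(z-c)$. If $\|u\|\le 1$, change nothing. Otherwise let $w=u/\|u\|$ and, for $\gamma\ge 0$, $$a=e^{\gamma},\qquad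 \frac1{\alpha'}=\frac1\alpha+2\gamma,\qquad b=1+\frac{\alpha-\alpha'}2,\qquad c'=-\alpha+\alpha' a;$$ let $\gamma$ be the root of $a+c'=\|u\|$, and replace $(A,c,\alpha)$ by $\big((\tfrac1b I+(\tfrac1a-\tfrac1b)ww^{\top})A,\ c+c'A^{-1}w,\ \alpha'\big)$. Two-phase algorithm. Let $T=\max(2,d\log d)$. Phase I starts with $A_0=\frac1{r_0}I$, $\alpha_0=1$, and keeps the center $c_0$ and a ball of radius $\rho$ (initially $\rho=r_0$): on receiving $z_t$ with $\|z_t-c_0\|\le r_0T$, if $\|z_t-c_0\|>\rho$ it sets $\rho=\|z_t-c_0\|$, $A_t=\frac1\rho I$, $\alpha_t=r_0/\rho$, and otherwise it changes nothing. On the first $z_t$ with $\|z_t-c_0\|>r_0T$, it goes over to Phase II: it applies the full update with $z_t$ to $(\frac1{r_0T}I,\,c_0,\,\frac1T)$. From then on it applies the full update with every new point. Theorem. There is an absolute constant $C$ such that for all $d\ge 1$, $c_0\in\mathbb R^d$ and $r_0>0$ the two-phase algorithm is monotone with $\alpha_t\in(0,1]$ and $A_t$ non-singular, and satisfies, for every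 stream, $\operatorname{conv}\{z_1,\dots,z_t\}\subseteq c_t+\mathcal E_t$ at every step $t$. If the stream ends after $n$ points and $c_0+r_0B\subseteq Z=\operatorname{conv}\{z_1,\dots,z_n\}$, then $$c_n+\alpha_n\mathcal E_n\subseteq Z\subseteq c_n+\mathcal E_n,\qquad \frac1{\alpha_n}\le C\max\Big(1,\ \min\Big(\frac{R(Z)}{r_0},\ d\log\frac{R(Z)}{r_0}\Big)\Big).$$ Running time and memory. Consider programs for a machine with real numbers: a program is a fixed finite text independent of $d$, of the stream and of $n$, and sees only its memory and the current point; arithmetic operations, square roots, $\exp$, $\log$, comparisons, memory accesses and passes through a loop cost one step each. (a) If the root $\gamma$ above, as a function of $\alpha$ and $\|u\|$, is available as a subroutine with unit cost, then some program computes exactly the output $(A_t,c_t,\alpha_t)$ of the two-phase algorithm after every point, with a memory of $O(d^2)$ real numbers and in $\widetilde O(nd^2)$ steps in total for $n\ge1$ points. (b) Without this subroutine, some program is a monotone streaming rounding algorithm with all the guarantees stated above for the two-phase algorithm, again with a memory of $O(d^2)$ real numbers and in $\widetilde O(nd^2)$ steps. Here $\widetilde O(nd^2)$ means at most $C\,n\,d^2(1+\log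 d)^k$ with absolute constants $C,k$. -/

import Mathlib

open scoped Pointwise

noncomputable section

namespace StreamingEllipsoid

/-! ### Geometry -/

/-- `ℝ^d` with the Euclidean norm. -/
abbrev Vec (d : ℕ) : Type := EuclideanSpace ℝ (Fin d)

/-- Matrix-vector product on `ℝ^d`. -/
def mv {d : ℕ} (A : Matrix (Fin d) (Fin d) ℝ) (x : Vec d) : Vec d :=
  WithLp.toLp 2 (A.mulVec x.ofLp)

/-- The origin-centered set `{x : ‖A x‖ ≤ 1}`; an ellipsoid when `A` is non-singular. -/
def ellipsoid {d : ℕ} (A : Matrix (Fin d) (Fin d) ℝ) : Set (Vec d) :=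
  {x | ‖mv A x‖ ≤ 1}

/-- What a streaming ellipsoidal rounding algorithm maintains: the matrix of an origin-centered
ellipsoid, a center and a scaling factor. -/
@[ext] structure Rounding (d : ℕ) where
  /-- The matrix of the ellipsoid. -/
  A : Matrix (Fin d) (Fin d) ℝ
  /-- The center. -/
  c : Vec d
  /-- The scaling factor. -/
  α : ℝ

/-- The outer ellipsoid `c + E`. -/
def Rounding.outer {d : ℕ} (s : Rounding d) : Set (Vec d) :=
  s.c +ᵥ ellipsoid s.A

/-- The inner ellipsoid `c + α E`. -/
def Rounding.inner {d : ℕ} (s : Rounding d) : Set (Vec d) :=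
  s.c +ᵥ (s.α • ellipsoid s.A)

/-- The convex hull of the first `t` points of the stream `z 0, z 1, z 2, …`. -/
def hull {d : ℕ} (z : ℕ → Vec d) (t : ℕ) : Set (Vec d) :=
  convexHull ℝ (z '' Set.Iio t)

/-- The circumradius: the least radius of a ball containing `K`. -/
def circumradius {d : ℕ} (K : Set (Vec d)) : ℝ :=
  sInf {R : ℝ | 0 ≤ R ∧ ∃ c : Vec d, K ⊆ Metric.closedBall c R}

/-- The guarantees of a monotone streaming rounding algorithm with initial ball `c₀ + r₀ B`, on
the stream `z`; `s t` is what the algorithm maintains after having received the first `t` points.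
The final guarantee is stated for every possible length `n` of the stream. -/
structure Guarantee {d : ℕ} (C : ℝ) (c₀ : Vec d) (r₀ : ℝ) (z : ℕ → Vec d)
    (s : ℕ → Rounding d) : Prop where
  /-- The initial ellipsoid is the given ball. -/
  init_outer : (s 0).outer = Metric.closedBall c₀ r₀
  /-- The initial scaling factor is `1`. -/
  init_alpha : (s 0).α = 1
  /-- The maintained sets are ellipsoids. -/
  nonsingular : ∀ t, IsUnit (s t).A.det
  /-- The scaling factors lie in `(0, 1]`. -/
  alpha_mem : ∀ t, 0 < (s t).α ∧ (s t).α ≤ 1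
  /-- Monotonicity of the outer ellipsoids. -/
  monotone_outer : ∀ t, convexHull ℝ ((s t).outer ∪ {z t}) ⊆ (s (t + 1)).outer
  /-- Monotonicity of the inner ellipsoids. -/
  monotone_inner : ∀ t, (s (t + 1)).inner ⊆ convexHull ℝ ((s t).inner ∪ {z t})
  /-- At every timestep the outer ellipsoid contains the points received so far. -/
  covers : ∀ t, hull z t ⊆ (s t).outer
  /-- At the end of the stream: an ellipsoidal rounding with the claimed approximation factor. -/
  final : ∀ n, Metric.closedBall c₀ r₀ ⊆ hull z n →
    (s n).inner ⊆ hull z n ∧ hull z n ⊆ (s n).outer ∧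
    1 / (s n).α ≤ C * max 1 (min (circumradius (hull z n) / r₀)
      (d * Real.log (circumradius (hull z n) / r₀)))

/-! ### The two-phase algorithm -/

/-- Length of the long semiaxis of the updated ellipsoid. -/
def aPar (γ : ℝ) : ℝ := Real.exp γ

/-- The updated scaling factor. -/
def alphaPar (α γ : ℝ) : ℝ := 1 / (1 / α + 2 * γ)

/-- Length of the other semiaxes of the updated ellipsoid. -/
def bPar (α γ : ℝ) : ℝ := 1 + (α - alphaPar α γ) / 2

/-- Shift of the center. -/
def cPar (α γ : ℝ) : ℝ := -α + alphaPar α γ * aPar γ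

/-- The `γ ≥ 0` with `a(γ) + c(γ) = x` (it exists and is unique if `0 < α ≤ 1/2` and `1 ≤ x`). -/
def gammaStar (α x : ℝ) : ℝ := sInf {γ : ℝ | 0 ≤ γ ∧ aPar γ + cPar α γ = x}

/-- The full update step. -/
def fullUpdate {d : ℕ} (s : Rounding d) (z : Vec d) : Rounding d :=
  let u : Vec d := mv s.A (z - s.c)
  let w : Vec d := ‖u‖⁻¹ • u
  if 1 < ‖u‖ then
    let γ : ℝ := gammaStar s.α ‖u‖
    let Ahat : Matrix (Fin d) (Fin d) ℝ :=
      (1 / bPar s.α γ) • (1 : Matrix (Fin d) (Fin d) ℝ) +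
        (1 / aPar γ - 1 / bPar s.α γ) • Matrix.vecMulVec w.ofLp w.ofLp
    { A := Ahat * s.A
      c := s.c + cPar s.α γ • mv s.A⁻¹ w
      α := alphaPar s.α γ }
  else s

/-- The approximation factor at which the algorithm leaves its first phase: `d log d`, but at
least `2`, so that the full update is only used with a scaling factor of at most `1/2`. -/
def threshold (d : ℕ) : ℝ := max 2 (d * Real.log d)

/-- The ball of radius `ρ` around `c` with scaling factor `α`. -/
def ballRounding {d : ℕ} (c : Vec d) (ρ α : ℝ) : Rounding d where
  A := (1 / ρ) • (1 : Matrix (Fin d) (Fin d) ℝ)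
  c := c
  α := α

/-- The state of the algorithm between two points. -/
structure AlgState (d : ℕ) where
  /-- Has the second phase begun? -/
  phaseII : Bool
  /-- The radius of the outer ball of the first phase, as a multiple of `r₀`. -/
  R : ℝ
  /-- What the algorithm maintains. -/
  out : Rounding d

/-- The initial state. -/
def algInit {d : ℕ} (c₀ : Vec d) (r₀ : ℝ) : AlgState d where
  phaseII := false
  R := 1
  out := ballRounding c₀ r₀ 1

/-- Processing the point `z`. -/
def algStep {d : ℕ} (c₀ : Vec d) (r₀ : ℝ) (s : AlgState d) (z : Vec d) : AlgState d :=
  if s.phaseII = true then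
    { s with out := fullUpdate s.out z }
  else if ‖z - c₀‖ ≤ r₀ * threshold d then
    if r₀ * s.R < ‖z - c₀‖ then
      { phaseII := false
        R := ‖z - c₀‖ / r₀
        out := ballRounding c₀ ‖z - c₀‖ (r₀ / ‖z - c₀‖) }
    else s
  else
    { phaseII := true
      R := s.R
      out := fullUpdate (ballRounding c₀ (r₀ * threshold d) (1 / threshold d)) z }

/-- The state of the algorithm after the first `t` points of the stream `z`. -/
def algState {d : ℕ} (c₀ : Vec d) (r₀ : ℝ) (z : ℕ → Vec d) : ℕ → AlgState d
  | 0 => algInit c₀ r₀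
  | t + 1 => algStep c₀ r₀ (algState c₀ r₀ z t) (z t)

/-- What the algorithm maintains after the first `t` points of the stream `z`. -/
def algOut {d : ℕ} (c₀ : Vec d) (r₀ : ℝ) (z : ℕ → Vec d) (t : ℕ) : Rounding d :=
  (algState c₀ r₀ z t).out

/-! ### Real-number streaming programs with a cost measure

A program is a finite text that does not depend on the dimension, the stream or its length. Its
memory has a prescribed number of cells, each holding one real number. Bounded loops over
natural-number counters are the only control structure besides conditionals. Every node of an
expression, every assignment, every test and every pass through a loop costs one step. -/

/-- Index expressions. -/
inductive NExpr
  /-- A constant. -/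
  | lit (k : ℕ)
  /-- The dimension. -/
  | dim
  /-- A loop counter. -/
  | var (v : ℕ)
  /-- Sum. -/
  | add (e f : NExpr)
  /-- Product. -/
  | mul (e f : NExpr)

/-- The value of an index expression, for the values `σ` of the loop counters. -/
def NExpr.val (d : ℕ) (σ : ℕ → ℕ) : NExpr → ℕ
  | .lit k => k
  | .dim => d
  | .var v => σ v
  | .add e f => e.val d σ + f.val d σ
  | .mul e f => e.val d σ * f.val d σ

/-- The number of steps needed for an index expression. -/
def NExpr.cost : NExpr → ℕ
  | .lit _ => 1
  | .dim => 1
  | .var _ => 1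
  | .add e f => e.cost + f.cost + 1
  | .mul e f => e.cost + f.cost + 1

/-- Real expressions. -/
inductive RExpr
  /-- A natural number, as a real number. -/
  | nat (e : NExpr)
  /-- The content of a memory cell. -/
  | mem (e : NExpr)
  /-- A coordinate of the current input vector. -/
  | inp (e : NExpr)
  /-- Sum. -/
  | add (x y : RExpr)
  /-- Difference. -/
  | sub (x y : RExpr)
  /-- Product. -/
  | mul (x y : RExpr)
  /-- Quotient. -/
  | div (x y : RExpr)
  /-- Square root. -/
  | sqrt (x : RExpr)
  /-- Exponential. -/
  | exp (x : RExpr)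
  /-- Natural logarithm. -/
  | log (x : RExpr)
  /-- A call of the subroutine, if one is available. -/
  | call (x y : RExpr)

/-- The content of the cell with address `i` of a memory with `M` cells (`0` if there is none). -/
def readCell {M : ℕ} (m : Fin M → ℝ) (i : ℕ) : ℝ :=
  if h : i < M then m ⟨i, h⟩ else 0

/-- Writing to the cell with address `i` (without effect if there is none). -/
def writeCell {M : ℕ} (m : Fin M → ℝ) (i : ℕ) (x : ℝ) : Fin M → ℝ :=
  fun j => if (j : ℕ) = i then x else m j

/-- The value of a real expression: `G` is the subroutine, `inp` the current input vector, `σ` the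
loop counters, `m` the memory. -/
def RExpr.val (G : ℝ → ℝ → ℝ) (d : ℕ) (inp : ℕ → ℝ) (σ : ℕ → ℕ) {M : ℕ} (m : Fin M → ℝ) :
    RExpr → ℝ
  | .nat e => (e.val d σ : ℝ)
  | .mem e => readCell m (e.val d σ)
  | .inp e => inp (e.val d σ)
  | .add x y => x.val G d inp σ m + y.val G d inp σ m
  | .sub x y => x.val G d inp σ m - y.val G d inp σ m
  | .mul x y => x.val G d inp σ m * y.val G d inp σ m
  | .div x y => x.val G d inp σ m / y.val G d inp σ m
  | .sqrt x => Real.sqrt (x.val G d inp σ m)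
  | .exp x => Real.exp (x.val G d inp σ m)
  | .log x => Real.log (x.val G d inp σ m)
  | .call x y => G (x.val G d inp σ m) (y.val G d inp σ m)

/-- The number of steps needed for a real expression. -/
def RExpr.cost : RExpr → ℕ
  | .nat e => e.cost + 1
  | .mem e => e.cost + 1
  | .inp e => e.cost + 1
  | .add x y => x.cost + y.cost + 1
  | .sub x y => x.cost + y.cost + 1
  | .mul x y => x.cost + y.cost + 1
  | .div x y => x.cost + y.cost + 1
  | .sqrt x => x.cost + 1
  | .exp x => x.cost + 1
  | .log x => x.cost + 1
  | .call x y => x.cost + y.cost + 1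

/-- Commands. -/
inductive Cmd
  /-- Do nothing. -/
  | skip
  /-- Write the value of `x` to the cell with address `e`. -/
  | assign (e : NExpr) (x : RExpr)
  /-- One command after the other. -/
  | seq (p q : Cmd)
  /-- If `x ≤ y` then `p` else `q`. -/
  | ifLe (x y : RExpr) (p q : Cmd)
  /-- Execute `p` for the values `0, 1, …, e - 1` of the loop counter `v`. -/
  | loop (v : ℕ) (e : NExpr) (p : Cmd)

/-- `k` passes through a loop with body `f`, from the memory and step count `s`. -/
def passes {S : Type} (f : ℕ → S → S × ℕ) (s : S × ℕ) : ℕ → S × ℕ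
  | 0 => s
  | k + 1 =>
    let p := passes f s k
    let q := f k p.1
    (q.1, p.2 + q.2 + 1)

/-- Executing a command: the new memory and the number of steps. -/
def Cmd.exec (G : ℝ → ℝ → ℝ) (d : ℕ) (inp : ℕ → ℝ) {M : ℕ} :
    Cmd → (ℕ → ℕ) → (Fin M → ℝ) → (Fin M → ℝ) × ℕ
  | .skip, _, m => (m, 1)
  | .assign e x, σ, m =>
    (writeCell m (e.val d σ) (x.val G d inp σ m), e.cost + x.cost + 1)
  | .seq p q, σ, m =>
    let r := p.exec G d inp σ m
    let r' := q.exec G d inp σ r.1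
    (r'.1, r.2 + r'.2)
  | .ifLe x y p q, σ, m =>
    let r := if x.val G d inp σ m ≤ y.val G d inp σ m then p.exec G d inp σ m
      else q.exec G d inp σ m
    (r.1, x.cost + y.cost + r.2 + 1)
  | .loop v e p, σ, m =>
    passes (fun i m' => p.exec G d inp (Function.update σ v i) m') (m, e.cost + 1) (e.val d σ)

/-- A streaming program: `init` is executed once, on the input `(c₀, r₀)`; then `step` is executed
for every point of the stream, on that point. Only the memory is kept in between. -/
structure Prog where
  /-- The initialization. -/
  init : Cmd
  /-- The processing of one point. -/
  step : Cmd

/-- A vector as an input. -/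
def vecInput {d : ℕ} (x : Vec d) : ℕ → ℝ :=
  fun i => if h : i < d then x ⟨i, h⟩ else 0

/-- The input `(c₀, r₀)`: the coordinates of `c₀`, followed by `r₀`. -/
def initInput {d : ℕ} (c₀ : Vec d) (r₀ : ℝ) : ℕ → ℝ :=
  fun i => if h : i < d then c₀ ⟨i, h⟩ else if i = d then r₀ else 0

/-- The memory (of `M` cells, initially `0`) and the total number of steps after the first `t`
points of the stream `z`. -/
def Prog.run (P : Prog) (G : ℝ → ℝ → ℝ) (M : ℕ) {d : ℕ} (c₀ : Vec d) (r₀ : ℝ)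
    (z : ℕ → Vec d) : ℕ → (Fin M → ℝ) × ℕ
  | 0 => P.init.exec G d (initInput c₀ r₀) (fun _ => 0) (fun _ => 0)
  | t + 1 =>
    let r := P.run G M c₀ r₀ z t
    let r' := P.step.exec G d (vecInput (z t)) (fun _ => 0) r.1
    (r'.1, r.2 + r'.2)

/-- The first `d² + d + 1` memory cells, read as a matrix (row by row), a center and a scaling
factor. -/
def readRounding (d : ℕ) {M : ℕ} (m : Fin M → ℝ) : Rounding d where
  A := fun i j => readCell m ((i : ℕ) * d + (j : ℕ))
  c := WithLp.toLp 2 (fun i => readCell m (d * d + (i : ℕ)))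
  α := readCell m (d * d + d)

/-- What the program maintains after the first `t` points of the stream `z`. -/
def Prog.out (P : Prog) (G : ℝ → ℝ → ℝ) (M : ℕ) {d : ℕ} (c₀ : Vec d) (r₀ : ℝ)
    (z : ℕ → Vec d) (t : ℕ) : Rounding d :=
  readRounding d (P.run G M c₀ r₀ z t).1

/-- The total number of steps for the first `n` points of the stream `z`. -/
def Prog.steps (P : Prog) (G : ℝ → ℝ → ℝ) (M : ℕ) {d : ℕ} (c₀ : Vec d) (r₀ : ℝ)
    (z : ℕ → Vec d) (n : ℕ) : ℕ :=
  (P.run G M c₀ r₀ z n).2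

/-- No subroutine is available: a call only returns `0`. -/
def noSubroutine : ℝ → ℝ → ℝ := fun _ _ => 0

end StreamingEllipsoid

end

namespace StreamingEllipsoid

/-! ### Scalar inequalities for the update step -/

/-! In the coordinates `p = A (y - c)` the old outer set is the unit ball, the old inner set is the
ball of radius `α`, and the new point is `x w` with `‖w‖ = 1`, `x > 1`. The new ellipsoid has
semiaxis `a` along `w` and `b` across it. Its center `(α' a - α) w` is chosen so that the new inner
ellipsoid touches the old inner ball at `-α w`, and `a` so that the new outer ellipsoid touches the
new point. By rotational symmetry both monotonicity inclusions concern only the coordinate `y` along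
`w` and the squared norm `q`. The outer one is a quadratic inequality (`center_sq_le`, `ball_le`).
The inner one says that the new inner ellipsoid fits into the hull of a ball and a point, a ball
continued by a tangent cone (`tangency`, `exists_weight`).

The exact equation `a = exp γ` is not needed for this. `ValidGrowth` isolates what is: `exp γ ≤ a`,
an upper bound on `a (1 - γ)`, and `α ≤ 1/2`. Both the root of the theorem (`rootRule`) and the
closed form `γ = log ((x + α) / (1 + α))` (`logRule`) qualify, so the same analysis covers both
programs.

The approximation factor comes from a potential. An update adds `2γ` to `1/α` and divides `|det A|`
by `a b^(d-1) ≥ exp γ`, so `1/α + 2 log |det A|` never increases (`update_bounds`). At the end the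
inner ellipsoid lies in `Z`, hence in a ball of radius `R`, and comparing volumes gives `α^d / |det
A| ≤ R^d`. With `X = 1/α`, `Y = R(Z)/r₀` and threshold `T`, it follows that `X ≤ T + 2 d log Y + 2 d
log X`. The second phase begins only after a point farther than `r₀ T`, so `Y ≥ (T + 1)/2`; this
makes `T`, `d` and `d log d` all `O(d log Y)`, and `d log Y = O(Y)`. In the first phase `X` is
itself a distance divided by `r₀`, and `X ≤ T`.

For the programs, `A⁻¹ w = (z - c) / ‖u‖` avoids any inversion, and `A` changes by a scaling and a
rank-one term `u (uᵀ A)`. One point thus costs `O(d²)` steps, without a logarithmic factor. -/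

theorem alphaPar_eq {α γ : ℝ} (hα : 0 < α) (hγ : 0 ≤ γ) :
    alphaPar α γ = α / (1 + 2 * α * γ) := by
  have h : 0 < 1 + 2 * α * γ := by positivity
  unfold alphaPar
  have : 1 / α + 2 * γ = (1 + 2 * α * γ) / α := by field_simp
  rw [this, one_div_div]

theorem alphaPar_pos {α γ : ℝ} (hα : 0 < α) (hγ : 0 ≤ γ) : 0 < alphaPar α γ := by
  unfold alphaPar
  positivity

theorem alphaPar_le_self {α γ : ℝ} (hα : 0 < α) (hγ : 0 ≤ γ) : alphaPar α γ ≤ α := by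
  rw [alphaPar_eq hα hγ]
  apply div_le_self hα.le
  have : 0 ≤ 2 * α * γ := by positivity
  linarith

theorem exp_mul_one_sub_le_one (γ : ℝ) : Real.exp γ * (1 - γ) ≤ 1 := by
  calc _ ≤ Real.exp γ * Real.exp (-γ) := by
        gcongr
        linarith [Real.add_one_le_exp (-γ)]
    _ = 1 := by rw [← Real.exp_add, add_neg_cancel, Real.exp_zero]

/-- Conditions on the growth `γ` and the long semiaxis `a` of an update with the scaling factor `α`
that make the update monotone. -/
structure ValidGrowth (α γ a : ℝ) : Prop where
  alpha_pos : 0 < α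
  alpha_le : α ≤ 1 / 2
  gamma_nonneg : 0 ≤ γ
  exp_le : Real.exp γ ≤ a
  le_one_add : a * (1 - γ) ≤ (1 + α) / (1 + alphaPar α γ)

namespace ValidGrowth

variable {α γ a : ℝ}

theorem one_add_le (h : ValidGrowth α γ a) : 1 + γ ≤ a := by
  linarith [h.exp_le, Real.add_one_le_exp γ]

theorem one_le (h : ValidGrowth α γ a) : 1 ≤ a := by
  linarith [h.one_add_le, h.gamma_nonneg]

theorem alphaPar_pos (h : ValidGrowth α γ a) : 0 < alphaPar α γ :=
  StreamingEllipsoid.alphaPar_pos h.alpha_pos h.gamma_nonneg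

theorem alphaPar_le (h : ValidGrowth α γ a) : alphaPar α γ ≤ α :=
  alphaPar_le_self h.alpha_pos h.gamma_nonneg

theorem bPar_eq (h : ValidGrowth α γ a) :
    bPar α γ = (1 + 2 * α * γ + α ^ 2 * γ) / (1 + 2 * α * γ) := by
  have h1 := h.alpha_pos
  have h2 := h.gamma_nonneg
  have h3 : 0 < 1 + 2 * α * γ := by positivity
  rw [bPar, alphaPar_eq h1 h2]
  field_simp
  ring

theorem one_le_bPar (h : ValidGrowth α γ a) : 1 ≤ bPar α γ := by
  have := h.alphaPar_le
  unfold bPar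
  linarith

theorem bPar_le (h : ValidGrowth α γ a) : bPar α γ ≤ 5 / 4 := by
  have := h.alphaPar_pos
  have := h.alpha_le
  unfold bPar
  linarith

theorem growth_pos (h : ValidGrowth α γ a) : 1 ≤ 1 + 2 * α * γ := by
  have h1 := h.alpha_pos
  have h2 := h.gamma_nonneg
  have : 0 ≤ 2 * α * γ := by positivity
  linarith

theorem growth_le (h : ValidGrowth α γ a) : 1 + 2 * α * γ ≤ a := by
  have h1 := h.one_add_le
  nlinarith [h.alpha_le, h.gamma_nonneg, h.alpha_pos]

theorem bPar_le_growth (h : ValidGrowth α γ a) : bPar α γ ≤ 1 + 2 * α * γ := by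
  have h1 := h.alpha_pos
  have h2 := h.gamma_nonneg
  have h3 := h.growth_pos
  rw [h.bPar_eq, div_le_iff₀ (by linarith)]
  have : α ^ 2 * γ ≤ 2 * α * γ := by
    have : 0 ≤ α * γ := by positivity
    nlinarith [h.alpha_le]
  nlinarith

/-- The tangency condition for the cone spanned by the new point and the old inner ellipsoid. -/
theorem tangency (h : ValidGrowth α γ a) :
    bPar α γ ^ 2 * alphaPar α γ ^ 2 * (a * (1 + alphaPar α γ) - 2 * α) ≤
      a * (1 - alphaPar α γ) * α ^ 2 := by
  have h1 := h.alpha_pos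
  have h2 := h.gamma_nonneg
  have h3 := h.growth_pos
  have ha := h.one_le
  have hl := h.le_one_add
  have hb := h.bPar_eq
  set α' := alphaPar α γ with hα'
  have e : α' = α / (1 + 2 * α * γ) := alphaPar_eq h1 h2
  have h4 := h.alphaPar_pos
  rw [← hα'] at h4
  rw [le_div_iff₀ (by linarith)] at hl
  set D := 1 + 2 * α * γ with hD
  have hαD : α = α' * D := by rw [e]; field_simp
  have hbD : bPar α γ * D = D + α ^ 2 * γ := by rw [hb]; field_simp
  -- `1 + α' - 2α/a ≤ (1 + α')(D - α)/(1 + α)`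
  have k1 : (1 + α) * (a * (1 + α') - 2 * α) ≤ a * (1 + α') * (D - α) := by
    have : 2 * α * (a * (1 - γ) * (1 + α')) ≤ 2 * α * (1 + α) :=
      mul_le_mul_of_nonneg_left hl (by linarith)
    rw [hD]
    nlinarith
  -- This is `b² ≤ D` with denominators cleared. As `α ≤ 1/2`, `α² γ ≤ (D - 1)/4`, and `16 D³ - (5D
  -- - 1)² = (D - 1)(16 D² - 9 D + 1)`.
  have k2 : (D + α ^ 2 * γ) ^ 2 ≤ D ^ 3 := by
    have q : α ^ 2 * γ = α * (D - 1) / 2 := by rw [hD]; ring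
    have q1 : α ^ 2 * γ ≤ (D - 1) / 4 := by
      rw [q]; nlinarith [h.alpha_le]
    have q2 : (D + α ^ 2 * γ) ^ 2 ≤ (D + (D - 1) / 4) ^ 2 := by
      apply pow_le_pow_left₀ (by positivity)
      linarith
    nlinarith [mul_nonneg (sub_nonneg.2 h3) (show 0 ≤ 16 * D ^ 2 - 9 * D + 1 by nlinarith)]
  have k3 : D + α ≤ (1 + α) * D := by nlinarith
  have hDα : 0 < D - α := by linarith [h.alpha_le]
  have k4 : bPar α γ ^ 2 ≤ D := by
    have : (bPar α γ * D) ^ 2 ≤ D ^ 3 := by rw [hbD]; exact k2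
    have hD2 : 0 < D ^ 2 := by positivity
    nlinarith
  have h5 : 0 ≤ 1 - α' := by
    have := h.alphaPar_le
    linarith [h.alpha_le]
  by_cases hneg : a * (1 + α') - 2 * α ≤ 0
  · have : 0 ≤ a * (1 - α') * α ^ 2 := by positivity
    have : bPar α γ ^ 2 * α' ^ 2 * (a * (1 + α') - 2 * α) ≤ 0 :=
      mul_nonpos_of_nonneg_of_nonpos (by positivity) hneg
    linarith
  push Not at hneg
  -- The claim with `α = α' D` substituted and `α'²` cancelled. After multiplication by `1 + α` it
  -- follows from `b² ≤ D`, `(1 + α') D = D + α` and `(1 - α') D = D - α`.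
  have k5 : bPar α γ ^ 2 * (a * (1 + α') - 2 * α) ≤ a * (1 - α') * D ^ 2 := by
    have q1 : (1 + α) * (bPar α γ ^ 2 * (a * (1 + α') - 2 * α)) ≤ D * (a * (1 + α') * (D - α)) := by
      calc (1 + α) * (bPar α γ ^ 2 * (a * (1 + α') - 2 * α))
          = bPar α γ ^ 2 * ((1 + α) * (a * (1 + α') - 2 * α)) := by ring
        _ ≤ D * (a * (1 + α') * (D - α)) := by
          apply mul_le_mul k4 k1 _ (by linarith)
          apply mul_nonneg (by linarith) hneg.le
    have q2 : D * (a * (1 + α') * (D - α)) = a * (D - α) * (D + α) := by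
      rw [hαD]; ring
    have q3 : a * (D - α) * (D + α) ≤ a * (D - α) * ((1 + α) * D) :=
      mul_le_mul_of_nonneg_left k3 (by positivity)
    have q4 : a * (D - α) * ((1 + α) * D) = (1 + α) * (a * (1 - α') * D ^ 2) := by
      rw [show (D - α) = (1 - α') * D by rw [sub_mul, ← hαD]; ring]; ring
    have : (1 + α) * (bPar α γ ^ 2 * (a * (1 + α') - 2 * α)) ≤
        (1 + α) * (a * (1 - α') * D ^ 2) := by linarith
    exact le_of_mul_le_mul_left this (by linarith)
  calc bPar α γ ^ 2 * α' ^ 2 * (a * (1 + α') - 2 * α)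
      = α' ^ 2 * (bPar α γ ^ 2 * (a * (1 + α') - 2 * α)) := by ring
    _ ≤ α' ^ 2 * (a * (1 - α') * D ^ 2) := mul_le_mul_of_nonneg_left k5 (by positivity)
    _ = a * (1 - α') * (α' * D) ^ 2 := by ring
    _ = _ := by rw [← hαD]

/-- The condition for the unit ball to lie in the new outer ellipsoid. -/
theorem center_sq_le (h : ValidGrowth α γ a) :
    bPar α γ ^ 2 * (alphaPar α γ * a - α) ^ 2 ≤
      (a ^ 2 - bPar α γ ^ 2) * (bPar α γ ^ 2 - 1) := by
  have h1 := h.alpha_pos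
  have h2 := h.gamma_nonneg
  have h3 := h.growth_pos
  have ha := h.one_le
  have haD := h.growth_le
  have hbD := h.bPar_le_growth
  have hb1 := h.one_le_bPar
  have hb2 := h.bPar_le
  have h4 := h.alphaPar_pos
  have hl := h.le_one_add
  have hba : bPar α γ = 1 + (α - alphaPar α γ) / 2 := rfl
  set α' := alphaPar α γ with hα'
  set b := bPar α γ with hb
  have e : α' = α / (1 + 2 * α * γ) := alphaPar_eq h1 h2
  set D := 1 + 2 * α * γ with hD
  have hαD : α = α' * D := by rw [e]; field_simp
  have hsub : α - α' = 2 * α * α' * γ := by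
    have : α - α' = α' * (D - 1) := by rw [mul_sub, ← hαD]; ring
    rw [this, hD]; ring
  have hbm : b - 1 = α * α' * γ := by rw [hba]; linarith
  -- Equivalently `a (1 - γ) ≤ D`, which follows from `le_one_add` because `1 + α ≤ (1 + α') D`.
  have k1 : a - D ≤ γ * a := by
    rw [le_div_iff₀ (by linarith)] at hl
    have hα'2 : α' ≤ α := h.alphaPar_le
    have : α - α' ≤ 2 * α * γ := by
      rw [hsub]
      have : 0 ≤ α * γ := by positivity
      nlinarith [h.alpha_le]
    have h5 : a * (1 - γ) ≤ 1 + 2 * α * γ := by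
      by_contra hc
      push Not at hc
      nlinarith
    linarith
  -- The center shift is `α' (a - D)`. One factor `a - D` of its square is bounded here, using `b ≤
  -- 5/4` to get `b² ≤ b + 1`; the other is kept and compared with `a - b` through `b ≤ D`.
  have key : b ^ 2 * (a - D) ≤ (a + b) * D * γ * (b + 1) := by
    have : b ^ 2 ≤ b + 1 := by nlinarith
    have q1 : b ^ 2 * (a - D) ≤ (b + 1) * (γ * a) :=
      mul_le_mul this k1 (by linarith) (by linarith)
    have q2 : γ * a ≤ (a + b) * D * γ := by
      have : a ≤ (a + b) * D := by nlinarith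
      nlinarith
    nlinarith
  have hc : α' * a - α = α' * (a - D) := by rw [mul_sub, ← hαD]
  rw [hc]
  calc b ^ 2 * (α' * (a - D)) ^ 2 = α' ^ 2 * (a - D) * (b ^ 2 * (a - D)) := by ring
    _ ≤ α' ^ 2 * (a - D) * ((a + b) * D * γ * (b + 1)) := by
      apply mul_le_mul_of_nonneg_left key
      have : 0 ≤ a - D := by linarith
      positivity
    _ = (a - D) * ((a + b) * (b + 1) * (α' * D * α' * γ)) := by ring
    _ = (a - D) * ((a + b) * (b + 1) * (b - 1)) := by rw [← hαD, hbm]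
    _ ≤ (a - b) * ((a + b) * (b + 1) * (b - 1)) := by
      apply mul_le_mul_of_nonneg_right (by linarith)
      apply mul_nonneg (mul_nonneg _ _) <;> linarith
    _ = _ := by ring

/-- The unit ball lies in the new outer ellipsoid: `y` and `q` stand for the coordinate along the
axis and the square of the norm of a point of the unit ball. -/
theorem ball_le (h : ValidGrowth α γ a) {y q : ℝ} (hq : q ≤ 1) (c : ℝ)
    (hc : c = alphaPar α γ * a - α) :
    (y - c) ^ 2 / a ^ 2 + (q - y ^ 2) / bPar α γ ^ 2 ≤ 1 := by
  have hk := h.center_sq_le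
  rw [← hc] at hk
  have ha := h.one_le
  have hb := h.one_le_bPar
  have hba : bPar α γ ≤ a := h.bPar_le_growth.trans h.growth_le
  set b := bPar α γ
  have hb2 : 0 < b ^ 2 := by positivity
  have ha2 : 0 < a ^ 2 := by positivity
  have hs : 0 ≤ a ^ 2 - b ^ 2 := by nlinarith
  suffices hh : b ^ 2 * (y - c) ^ 2 + a ^ 2 * (1 - y ^ 2) ≤ a ^ 2 * b ^ 2 by
    have : a ^ 2 * (q - y ^ 2) ≤ a ^ 2 * (1 - y ^ 2) :=
      mul_le_mul_of_nonneg_left (by linarith) ha2.le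
    rw [div_add_div _ _ ha2.ne' hb2.ne', div_le_one (by positivity)]
    linarith
  -- For `a = b` the center condition forces `c = 0`, and two concentric balls remain. Otherwise the
  -- slack is multiplied by `a² - b²` and written as a square in `y` plus the slack of
  -- `center_sq_le`.
  rcases hs.eq_or_lt with h0 | h0
  · rw [← h0, zero_mul] at hk
    have hc0 : c = 0 := by
      by_contra hne
      have : 0 < c ^ 2 := by positivity
      nlinarith
    have : a ^ 2 = b ^ 2 := by linarith
    rw [hc0, this]
    have := mul_nonneg hb2.le (show 0 ≤ b ^ 2 - 1 by nlinarith)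
    linarith
  · have : 0 ≤ (a ^ 2 - b ^ 2) * (a ^ 2 * b ^ 2 - b ^ 2 * (y - c) ^ 2 - a ^ 2 * (1 - y ^ 2)) := by
      have e : (a ^ 2 - b ^ 2) * (a ^ 2 * b ^ 2 - b ^ 2 * (y - c) ^ 2 - a ^ 2 * (1 - y ^ 2)) =
        ((a ^ 2 - b ^ 2) * y + b ^ 2 * c) ^ 2 +
          a ^ 2 * ((a ^ 2 - b ^ 2) * (b ^ 2 - 1) - b ^ 2 * c ^ 2) := by ring
      rw [e]
      have := mul_nonneg ha2.le (sub_nonneg.2 hk)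
      positivity
    linarith [nonneg_of_mul_nonneg_right this h0]

/-- The critical value is `s = δ²`: `δ² (1 - s)² - (1 - δ²)(δ² - s²) = (s - δ²)²`. This reduces the
inclusion of an ellipse in a cone, for all `s`, to the single inequality at the point of tangency.
-/
theorem quadratic_le {P κ δ s : ℝ} (h : κ * δ ^ 2 ≤ P * (1 - δ ^ 2)) (hδ : 0 < δ) (hP : 0 ≤ P)
    (hs : 0 ≤ δ ^ 2 - s ^ 2) : κ * (δ ^ 2 - s ^ 2) ≤ P * (1 - s) ^ 2 := by
  have : δ ^ 2 * (κ * (δ ^ 2 - s ^ 2)) ≤ δ ^ 2 * (P * (1 - s) ^ 2) := by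
    have h1 := mul_le_mul_of_nonneg_right h hs
    have h2 : 0 ≤ P * (s - δ ^ 2) ^ 2 := by positivity
    linarith
  exact le_of_mul_le_mul_left this (by positivity)

/-- The new inner ellipsoid lies in the convex hull of the old inner ellipsoid and the new point:
`y` and `q` stand for the coordinate along the axis and the square of the norm of a point of the new
inner ellipsoid, and `x` is the norm of the new point. -/
theorem exists_weight (h : ValidGrowth α γ a) {x y q c : ℝ} (hc : c = alphaPar α γ * a - α)
    (hx : a + c = x) (hx1 : 1 < x) (hq : y ^ 2 ≤ q)
    (hin : (y - c) ^ 2 / a ^ 2 + (q - y ^ 2) / bPar α γ ^ 2 ≤ alphaPar α γ ^ 2) :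
    ∃ l : ℝ, 0 ≤ l ∧ l < 1 ∧ q - 2 * l * x * y + l ^ 2 * x ^ 2 ≤ (1 - l) ^ 2 * α ^ 2 := by
  have hII := h.tangency
  have h1 := h.alpha_pos
  have ha := h.one_le
  have hb := h.one_le_bPar
  have h4 := h.alphaPar_pos
  have h5 := h.alphaPar_le
  have hαle := h.alpha_le
  have hba : bPar α γ ^ 2 ≤ a ^ 2 :=
    pow_le_pow_left₀ (by linarith) (h.bPar_le_growth.trans h.growth_le) 2
  clear h
  generalize bPar α γ = b at *
  generalize alphaPar α γ = α' at *
  have ha2 : 0 < a ^ 2 := by positivity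
  have hb2 : 0 < b ^ 2 := by positivity
  have hin' : b ^ 2 * (y - c) ^ 2 + a ^ 2 * (q - y ^ 2) ≤ a ^ 2 * b ^ 2 * α' ^ 2 := by
    rw [div_add_div _ _ ha2.ne' hb2.ne', div_le_iff₀ (by positivity)] at hin
    linarith
  have hr : 0 ≤ q - y ^ 2 := by linarith
  -- the range of `y`
  have hyc : (y - c) ^ 2 ≤ (a * α') ^ 2 := by
    have : b ^ 2 * (y - c) ^ 2 ≤ b ^ 2 * (a * α') ^ 2 := by
      linarith [mul_nonneg ha2.le hr]
    exact le_of_mul_le_mul_left this hb2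
  have haα : 0 ≤ a * α' := by positivity
  have hy1 := abs_le.1 (abs_le_of_sq_le_sq hyc haα)
  have hylow : -α ≤ y := by linarith [hy1.1, hc]
  have hyx : y < x := by
    have : a * α' < a * 1 := mul_lt_mul_of_pos_left (by linarith) (by linarith)
    linarith [hy1.2]
  -- the cone inequality
  have hH : 0 < x ^ 2 - α ^ 2 := by nlinarith
  have hxe : x = a * (1 + α') - α := by rw [← hx, hc]; ring
  have hK : (x ^ 2 - α ^ 2) * b ^ 2 * α' ^ 2 ≤ α ^ 2 * a ^ 2 * (1 - α' ^ 2) := by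
    have e : x ^ 2 - α ^ 2 = (a * (1 + α') - 2 * α) * (a * (1 + α')) := by rw [hxe]; ring
    rw [e]
    have := mul_le_mul_of_nonneg_left hII (show 0 ≤ a * (1 + α') by positivity)
    linarith
  -- Here `s = (y - c)/a` is the normalized coordinate along the axis; then `x - y = a (1 - s)`, and
  -- the section of the new inner ellipsoid has squared radius at most `b² (α'² - s²)`.
  have hquad : ∀ s : ℝ, 0 ≤ α' ^ 2 - s ^ 2 →
      b ^ 2 * (α' ^ 2 - s ^ 2) * (x ^ 2 - α ^ 2) ≤ α ^ 2 * (a * (1 - s)) ^ 2 := by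
    intro s hs
    have t := quadratic_le hK h4 (by positivity) hs
    calc _ = (x ^ 2 - α ^ 2) * b ^ 2 * (α' ^ 2 - s ^ 2) := by ring
      _ ≤ _ := t
      _ = _ := by ring
  have hcone : (q - y ^ 2) * (x ^ 2 - α ^ 2) ≤ α ^ 2 * (x - y) ^ 2 := by
    set s := (y - c) / a with hs
    have hys : y - c = a * s := by rw [hs]; field_simp
    have hxy : x - y = a * (1 - s) := by rw [mul_sub, ← hys, ← hx]; ring
    have hr2 : q - y ^ 2 ≤ b ^ 2 * (α' ^ 2 - s ^ 2) := by
      rw [hys] at hin'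
      have : a ^ 2 * (q - y ^ 2) ≤ a ^ 2 * (b ^ 2 * (α' ^ 2 - s ^ 2)) := by linarith
      exact le_of_mul_le_mul_left this ha2
    have hs2 : 0 ≤ α' ^ 2 - s ^ 2 := by
      rw [hys] at hyc
      have : a ^ 2 * s ^ 2 ≤ a ^ 2 * α' ^ 2 := by linarith
      linarith [le_of_mul_le_mul_left this ha2]
    rw [hxy]
    have t1 : (q - y ^ 2) * (x ^ 2 - α ^ 2) ≤ b ^ 2 * (α' ^ 2 - s ^ 2) * (x ^ 2 - α ^ 2) :=
      mul_le_mul_of_nonneg_right hr2 hH.le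
    exact t1.trans (hquad s hs2)
  have hx0 : 0 < x := by linarith
  -- The hyperplane `y = α²/x` contains the points where the tangent cone from the new point touches
  -- the ball of radius `α`. On its far side the point must lie in the ball itself, so the weight is
  -- `0`; on the near side it lies in the cone.
  by_cases hy : y * x ≤ α ^ 2
  · refine ⟨0, le_rfl, zero_lt_one, ?_⟩
    -- The new inner ellipsoid meets the axis at `-α` and `2 α' a - α`, so after cancelling `y + α`
    -- its inclusion in the ball is linear in `y`. As `b² ≤ a²`, it suffices to check it at the
    -- contact hyperplane, where the sections of cone and ball agree.
    have hlin : ∀ t : ℝ, t * x = α ^ 2 → b ^ 2 * (2 * α' * a - α - t) ≤ a ^ 2 * (α - t) := by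
      intro t ht
      have htx : t = α ^ 2 / x := by field_simp; linarith
      have ht0 : 0 < t := by rw [htx]; positivity
      have hta : t ≤ α := by
        by_contra hlt
        push Not at hlt
        nlinarith
      by_contra hcon
      push Not at hcon
      have hpos : 0 < 2 * α' * a - α - t := by
        by_contra hneg
        push Not at hneg
        linarith [mul_nonneg ha2.le (sub_nonneg.2 hta),
          mul_nonpos_of_nonneg_of_nonpos hb2.le hneg]
      set s := (t - c) / a with hs
      have hys : t - c = a * s := by rw [hs]; field_simp
      have hxy : x - t = a * (1 - s) := by rw [mul_sub, ← hys, ← hx]; ring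
      have hs2e : a ^ 2 * (α' ^ 2 - s ^ 2) = (2 * α' * a - α - t) * (t + α) := by
        have : a ^ 2 * (α' ^ 2 - s ^ 2) = (a * α') ^ 2 - (a * s) ^ 2 := by ring
        rw [this, ← hys, hc]; ring
      have hs2 : 0 < α' ^ 2 - s ^ 2 := by
        have : 0 < a ^ 2 * (α' ^ 2 - s ^ 2) := by rw [hs2e]; positivity
        exact (pos_iff_pos_of_mul_pos this).1 ha2
      have t3 := hquad s hs2.le
      rw [← hxy] at t3
      have e2 : α ^ 2 * (x - t) ^ 2 = (α ^ 2 - t ^ 2) * (x ^ 2 - α ^ 2) := by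
        rw [← ht]; ring
      rw [e2] at t3
      have t4 := le_of_mul_le_mul_right t3 hH
      have t5 : (t + α) * (b ^ 2 * (2 * α' * a - α - t)) ≤ (t + α) * (a ^ 2 * (α - t)) := by
        calc _ = b ^ 2 * (a ^ 2 * (α' ^ 2 - s ^ 2)) := by rw [hs2e]; ring
          _ = a ^ 2 * (b ^ 2 * (α' ^ 2 - s ^ 2)) := by ring
          _ ≤ a ^ 2 * (α ^ 2 - t ^ 2) := mul_le_mul_of_nonneg_left t4 ha2.le
          _ = _ := by ring
      have := le_of_mul_le_mul_left t5 (by linarith)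
      linarith
    have hend := hlin (α ^ 2 / x) (by field_simp)
    have hyt : y ≤ α ^ 2 / x := by rw [le_div_iff₀ hx0]; exact hy
    have hmid : b ^ 2 * (2 * α' * a - α - y) ≤ a ^ 2 * (α - y) := by
      have := mul_nonneg (sub_nonneg.2 hba) (sub_nonneg.2 hyt)
      linarith
    have := mul_le_mul_of_nonneg_left hmid (show 0 ≤ y + α by linarith)
    have e : a ^ 2 * (q - y ^ 2) ≤ a ^ 2 * (α ^ 2 - y ^ 2) := by
      have e1 : a ^ 2 * b ^ 2 * α' ^ 2 - b ^ 2 * (y - c) ^ 2 =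
          (y + α) * (b ^ 2 * (2 * α' * a - α - y)) := by rw [hc]; ring
      linarith
    have := le_of_mul_le_mul_left e ha2
    linarith
  · push Not at hy
    -- This weight maximizes the concave quadratic `(1 - l)² α² - (q - 2 l x y + l² x²)`; times `x²
    -- - α²`, the maximum is exactly the slack of the cone inequality.
    refine ⟨(x * y - α ^ 2) / (x ^ 2 - α ^ 2), ?_, ?_, ?_⟩
    · apply div_nonneg <;> linarith
    · rw [div_lt_one hH]; linarith [mul_lt_mul_of_pos_left hyx hx0]
    · set l := (x * y - α ^ 2) / (x ^ 2 - α ^ 2) with hl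
      have e1 : l * (x ^ 2 - α ^ 2) = x * y - α ^ 2 := by rw [hl]; field_simp
      have : (x ^ 2 - α ^ 2) * (q - 2 * l * x * y + l ^ 2 * x ^ 2) ≤
          (x ^ 2 - α ^ 2) * ((1 - l) ^ 2 * α ^ 2) := by
        have e3 : (x ^ 2 - α ^ 2) * ((1 - l) ^ 2 * α ^ 2) -
            (x ^ 2 - α ^ 2) * (q - 2 * l * x * y + l ^ 2 * x ^ 2) =
            α ^ 2 * (x - y) ^ 2 - (q - y ^ 2) * (x ^ 2 - α ^ 2) -
              (l * (x ^ 2 - α ^ 2) - (x * y - α ^ 2)) ^ 2 := by ring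
        rw [e1, sub_self] at e3
        linarith
      exact le_of_mul_le_mul_left this hH

end ValidGrowth

/-! ### Matrices and ellipsoids -/

section Matrices

variable {d : ℕ}

theorem mv_eq_toEuclideanLin (A : Matrix (Fin d) (Fin d) ℝ) (x : Vec d) :
    mv A x = Matrix.toEuclideanLin A x := rfl

theorem mv_add (A : Matrix (Fin d) (Fin d) ℝ) (x y : Vec d) : mv A (x + y) = mv A x + mv A y := by
  simp only [mv_eq_toEuclideanLin, map_add]

theorem mv_sub (A : Matrix (Fin d) (Fin d) ℝ) (x y : Vec d) : mv A (x - y) = mv A x - mv A y := by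
  simp only [mv_eq_toEuclideanLin, map_sub]

theorem mv_smul (A : Matrix (Fin d) (Fin d) ℝ) (r : ℝ) (x : Vec d) :
    mv A (r • x) = r • mv A x := by
  simp only [mv_eq_toEuclideanLin, map_smul]

theorem mv_mul (A B : Matrix (Fin d) (Fin d) ℝ) (x : Vec d) : mv (A * B) x = mv A (mv B x) := by
  simp [mv, Matrix.mulVec_mulVec]

theorem mv_smul_one (r : ℝ) (x : Vec d) :
    mv (r • (1 : Matrix (Fin d) (Fin d) ℝ)) x = r • x := by
  simp [mv, Matrix.smul_mulVec]

theorem mv_inv_mv {A : Matrix (Fin d) (Fin d) ℝ} (hA : IsUnit A.det) (x : Vec d) :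
    mv A⁻¹ (mv A x) = x := by
  rw [← mv_mul, Matrix.nonsing_inv_mul A hA]
  simpa using mv_smul_one 1 x

theorem mv_mv_inv {A : Matrix (Fin d) (Fin d) ℝ} (hA : IsUnit A.det) (x : Vec d) :
    mv A (mv A⁻¹ x) = x := by
  rw [← mv_mul, Matrix.mul_nonsing_inv A hA]
  simpa using mv_smul_one 1 x

theorem mv_stretch (p q : ℝ) (w x : Vec d) :
    mv (p • (1 : Matrix (Fin d) (Fin d) ℝ) + q • Matrix.vecMulVec w.ofLp w.ofLp) x =
      p • x + (q * inner ℝ w x) • w := by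
  ext i
  simp only [mv, Matrix.add_mulVec, Matrix.smul_mulVec, Matrix.one_mulVec,
    Matrix.vecMulVec_mulVec, PiLp.add_apply, PiLp.smul_apply, Pi.add_apply, Pi.smul_apply,
    smul_eq_mul, PiLp.inner_apply, dotProduct, RCLike.inner_apply, conj_trivial, op_smul_eq_smul]
  simp only [Finset.mul_sum, mul_comm, mul_left_comm]

theorem norm_stretch_sq {b a : ℝ} {w : Vec d} (hw : ‖w‖ = 1) (x : Vec d) :
    ‖(1 / b) • x + ((1 / a - 1 / b) * inner ℝ w x) • w‖ ^ 2 =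
      inner ℝ w x ^ 2 / a ^ 2 + (‖x‖ ^ 2 - inner ℝ w x ^ 2) / b ^ 2 := by
  rw [norm_add_sq_real, norm_smul, norm_smul, inner_smul_left, inner_smul_right, hw, mul_one,
    mul_pow, real_inner_comm w x]
  simp only [Real.norm_eq_abs, sq_abs, conj_trivial]
  ring

/-- The matrix determinant lemma for `b⁻¹ (1 + (b/a - 1) w wᵀ)`. The exponent `d - 1` is a natural
subtraction, whence `1 ≤ d`. -/
theorem det_stretch (hd : 1 ≤ d) {b a : ℝ} (hb : b ≠ 0) (ha : a ≠ 0) {w : Vec d} (hw : ‖w‖ = 1) :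
    ((1 / b) • (1 : Matrix (Fin d) (Fin d) ℝ) +
      (1 / a - 1 / b) • Matrix.vecMulVec w.ofLp w.ofLp).det = (1 / b) ^ (d - 1) * (1 / a) := by
  have h1 : ((1 / b) • (1 : Matrix (Fin d) (Fin d) ℝ) +
      (1 / a - 1 / b) • Matrix.vecMulVec w.ofLp w.ofLp) = (1 / b) •
      ((1 : Matrix (Fin d) (Fin d) ℝ) +
        Matrix.replicateCol Unit ((b / a - 1) • w.ofLp) * Matrix.replicateRow Unit w.ofLp) := by
    rw [← Matrix.vecMulVec_eq, Matrix.smul_vecMulVec, smul_add, smul_smul]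
    congr 2
    field_simp
  have hww : w.ofLp ⬝ᵥ w.ofLp = 1 := by
    have := EuclideanSpace.real_norm_sq_eq w
    rw [hw, one_pow] at this
    simp [this, dotProduct, sq]
  rw [h1, Matrix.det_smul, Matrix.det_one_add_replicateCol_mul_replicateRow, dotProduct_smul, hww,
    Fintype.card_fin]
  obtain ⟨k, rfl⟩ : ∃ k, d = k + 1 := ⟨d - 1, by omega⟩
  simp only [Nat.add_sub_cancel, smul_eq_mul, mul_one]
  rw [pow_succ]
  field_simp
  ring

end Matrices

namespace Rounding

variable {d : ℕ} {s : Rounding d}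

theorem mem_outer {y : Vec d} : y ∈ s.outer ↔ ‖mv s.A (y - s.c)‖ ≤ 1 := by
  rw [outer, Set.mem_vadd_set_iff_neg_vadd_mem]
  simp [ellipsoid, sub_eq_neg_add]

theorem mem_inner (hα : 0 < s.α) {y : Vec d} : y ∈ s.inner ↔ ‖mv s.A (y - s.c)‖ ≤ s.α := by
  rw [inner, Set.mem_vadd_set_iff_neg_vadd_mem, Set.mem_smul_set_iff_inv_smul_mem₀ hα.ne']
  simp only [ellipsoid, Set.mem_ofPred_eq, mv_smul, norm_smul, vadd_eq_add, norm_inv,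
    Real.norm_eq_abs, abs_of_pos hα, ← sub_eq_neg_add]
  rw [inv_mul_le_iff₀ hα, mul_one]

theorem convex_outer : Convex ℝ s.outer := by
  intro x hx y hy p q hp hq hpq
  rw [mem_outer] at *
  have e : p • x + q • y - s.c = p • (x - s.c) + q • (y - s.c) := by
    have : s.c = (p + q) • s.c := by rw [hpq, one_smul]
    nth_rw 1 [this]
    module
  rw [e, mv_add, mv_smul, mv_smul]
  calc _ ≤ ‖p • mv s.A (x - s.c)‖ + ‖q • mv s.A (y - s.c)‖ := norm_add_le _ _
    _ = p * ‖mv s.A (x - s.c)‖ + q * ‖mv s.A (y - s.c)‖ := by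
      rw [norm_smul, norm_smul, Real.norm_of_nonneg hp, Real.norm_of_nonneg hq]
    _ ≤ p * 1 + q * 1 := by gcongr
    _ = 1 := by linarith

/-- The volume of a subset `c + α E` of a ball of radius `R`. -/
theorem abs_det_inv_mul_pow_le (hA : IsUnit s.A.det) (hα : 0 < s.α) {x : Vec d} {R : ℝ}
    (hR : 0 ≤ R) (h : s.inner ⊆ Metric.closedBall x R) :
    |s.A.det|⁻¹ * s.α ^ d ≤ R ^ d := by
  have hdet : LinearMap.det (Matrix.toEuclideanLin s.A) = s.A.det := by
    rw [Matrix.toEuclideanLin_eq_toLin_orthonormal, LinearMap.det_toLin]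
  have hsub : (fun y => -s.c + y) ⁻¹' (Matrix.toEuclideanLin s.A ⁻¹' Metric.closedBall 0 s.α) ⊆
      Metric.closedBall x R := by
    intro y hy
    apply h
    rw [mem_inner hα, sub_eq_neg_add, mv_eq_toEuclideanLin]
    simpa using hy
  -- The inner ellipsoid is an affine preimage of the ball of radius `α`, so its volume has the
  -- factor `|det A|⁻¹ α^d`. The volume of the unit ball is positive and finite, and cancels.
  have hv := MeasureTheory.measure_mono (μ := MeasureTheory.volume) hsub
  rw [MeasureTheory.measure_preimage_add, MeasureTheory.Measure.addHaar_preimage_linearMap _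
    (by rw [hdet]; exact hA.ne_zero), hdet, MeasureTheory.Measure.addHaar_closedBall' _ _ hα.le,
    MeasureTheory.Measure.addHaar_closedBall' _ _ hR, ← mul_assoc] at hv
  have hpos : 0 < MeasureTheory.volume (Metric.closedBall (0 : Vec d) 1) :=
    Metric.measure_closedBall_pos _ _ one_pos
  have hfin : MeasureTheory.volume (Metric.closedBall (0 : Vec d) 1) ≠ ⊤ :=
    MeasureTheory.measure_closedBall_lt_top.ne
  rw [ENNReal.mul_le_mul_iff_left hpos.ne' hfin, ← ENNReal.ofReal_mul (by positivity),
    ENNReal.ofReal_le_ofReal_iff (by positivity)] at hv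
  simpa [finrank_euclideanSpace, abs_inv] using hv

end Rounding

/-! ### Update rules -/

/-- How the growth parameter `γ` and the long semiaxis `a` are chosen from the scaling factor and
the norm of the transformed new point. -/
structure UpdateRule where
  /-- The growth parameter. -/
  growth : ℝ → ℝ → ℝ
  /-- The long semiaxis. -/
  axis : ℝ → ℝ → ℝ

namespace UpdateRule

/-- The update step of an update rule. -/
noncomputable def update (U : UpdateRule) {d : ℕ} (s : Rounding d) (z : Vec d) : Rounding d :=
  let u : Vec d := mv s.A (z - s.c)
  let w : Vec d := ‖u‖⁻¹ • u
  if 1 < ‖u‖ then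
    let γ : ℝ := U.growth s.α ‖u‖
    let a : ℝ := U.axis s.α ‖u‖
    let Ahat : Matrix (Fin d) (Fin d) ℝ :=
      (1 / bPar s.α γ) • (1 : Matrix (Fin d) (Fin d) ℝ) +
        (1 / a - 1 / bPar s.α γ) • Matrix.vecMulVec w.ofLp w.ofLp
    { A := Ahat * s.A
      c := s.c + (-s.α + alphaPar s.α γ * a) • mv s.A⁻¹ w
      α := alphaPar s.α γ }
  else s

/-- The rule yields valid growth parameters, and the new ellipsoid touches the new point. -/
structure IsValid (U : UpdateRule) : Prop where
  validGrowth : ∀ α x, 0 < α → α ≤ 1 / 2 → 1 < x → ValidGrowth α (U.growth α x) (U.axis α x)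
  axis_add : ∀ α x, 0 < α → α ≤ 1 / 2 → 1 < x →
    U.axis α x + (alphaPar α (U.growth α x) * U.axis α x - α) = x

variable {U : UpdateRule} {d : ℕ} {s : Rounding d} {z : Vec d}

theorem update_of_norm_le (h : ‖mv s.A (z - s.c)‖ ≤ 1) : U.update s z = s := by
  simp [update, not_lt.2 h]

theorem update_alpha (h : 1 < ‖mv s.A (z - s.c)‖) :
    (U.update s z).α = alphaPar s.α (U.growth s.α ‖mv s.A (z - s.c)‖) := by
  simp [update, h]

theorem norm_normalize {u : Vec d} (h : 1 < ‖u‖) : ‖‖u‖⁻¹ • u‖ = 1 := by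
  rw [norm_smul, norm_inv, norm_norm, inv_mul_cancel₀ (by linarith)]

theorem update_det (hd : 1 ≤ d) (hv : ValidGrowth s.α (U.growth s.α ‖mv s.A (z - s.c)‖)
    (U.axis s.α ‖mv s.A (z - s.c)‖)) (h : 1 < ‖mv s.A (z - s.c)‖) :
    (U.update s z).A.det = (1 / bPar s.α (U.growth s.α ‖mv s.A (z - s.c)‖)) ^ (d - 1) *
      (1 / U.axis s.α ‖mv s.A (z - s.c)‖) * s.A.det := by
  have hb := hv.one_le_bPar
  have ha := hv.one_le
  simp only [update, h, if_true, Matrix.det_mul]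
  rw [det_stretch hd (by linarith) (by linarith) (norm_normalize h)]

/-- The transformed points of the new ellipsoid. -/
theorem norm_update_sq (hA : IsUnit s.A.det) (h : 1 < ‖mv s.A (z - s.c)‖) (y : Vec d) :
    let u := mv s.A (z - s.c)
    let w : Vec d := ‖u‖⁻¹ • u
    let p := mv s.A (y - s.c)
    let a := U.axis s.α ‖u‖
    let γ := U.growth s.α ‖u‖
    ‖mv (U.update s z).A (y - (U.update s z).c)‖ ^ 2 =
      (inner ℝ w p - (alphaPar s.α γ * a - s.α)) ^ 2 / a ^ 2 +
        (‖p‖ ^ 2 - inner ℝ w p ^ 2) / bPar s.α γ ^ 2 := by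
  intro u w p a γ
  have hw : ‖w‖ = 1 := norm_normalize h
  have e : mv (U.update s z).A (y - (U.update s z).c) =
      mv ((1 / bPar s.α γ) • (1 : Matrix (Fin d) (Fin d) ℝ) +
        (1 / a - 1 / bPar s.α γ) • Matrix.vecMulVec w.ofLp w.ofLp)
        (p - (alphaPar s.α γ * a - s.α) • w) := by
    simp only [update, h, if_true]
    rw [mv_mul, ← sub_sub, mv_sub s.A (y - s.c), mv_smul, mv_mv_inv hA]
    simp only [p, γ, a, w, u, neg_add_eq_sub]
  have e1 : inner ℝ w (p - (alphaPar s.α γ * a - s.α) • w) =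
      inner ℝ w p - (alphaPar s.α γ * a - s.α) := by
    rw [inner_sub_right, inner_smul_right, real_inner_self_eq_norm_sq, hw]; ring
  rw [e, mv_stretch, norm_stretch_sq hw, e1, norm_sub_sq_real, norm_smul, inner_smul_right,
    real_inner_comm w p, hw, mul_one, Real.norm_eq_abs, sq_abs]
  ring

theorem inner_sq_le {w p : Vec d} (hw : ‖w‖ = 1) : inner ℝ w p ^ 2 ≤ ‖p‖ ^ 2 := by
  have := abs_real_inner_le_norm w p
  rw [hw, one_mul] at this
  rw [← sq_abs]
  gcongr

theorem outer_subset_update (hU : U.IsValid) (hA : IsUnit s.A.det) (hα : 0 < s.α)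
    (hα2 : s.α ≤ 1 / 2) : s.outer ⊆ (U.update s z).outer := by
  rcases le_or_gt ‖mv s.A (z - s.c)‖ 1 with h | h
  · rw [update_of_norm_le h]
  · intro y hy
    have hv := hU.validGrowth s.α _ hα hα2 h
    rw [Rounding.mem_outer] at hy ⊢
    rw [← abs_norm, ← sq_le_one_iff_abs_le_one, norm_update_sq hA h]
    exact hv.ball_le (pow_le_one₀ (norm_nonneg _) hy) _ rfl

theorem mem_update_outer (hU : U.IsValid) (hA : IsUnit s.A.det) (hα : 0 < s.α)
    (hα2 : s.α ≤ 1 / 2) : z ∈ (U.update s z).outer := by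
  rcases le_or_gt ‖mv s.A (z - s.c)‖ 1 with h | h
  · rw [update_of_norm_le h, Rounding.mem_outer]
    exact h
  · have hv := hU.validGrowth s.α _ hα hα2 h
    have hx := hU.axis_add s.α _ hα hα2 h
    have ha := hv.one_le
    rw [Rounding.mem_outer, ← abs_norm, ← sq_le_one_iff_abs_le_one, norm_update_sq hA h,
      real_inner_smul_left, real_inner_self_eq_norm_sq]
    have e : ‖mv s.A (z - s.c)‖⁻¹ * ‖mv s.A (z - s.c)‖ ^ 2 = ‖mv s.A (z - s.c)‖ := by
      field_simp
    rw [e, sub_self, zero_div, add_zero, ← div_pow]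
    have : ‖mv s.A (z - s.c)‖ -
        (alphaPar s.α (U.growth s.α ‖mv s.A (z - s.c)‖) * U.axis s.α ‖mv s.A (z - s.c)‖ - s.α) =
        U.axis s.α ‖mv s.A (z - s.c)‖ := by linarith
    rw [this, div_self (by linarith), one_pow]

theorem update_inner_subset (hU : U.IsValid) (hA : IsUnit s.A.det) (hα : 0 < s.α)
    (hα2 : s.α ≤ 1 / 2) : (U.update s z).inner ⊆ convexHull ℝ (s.inner ∪ {z}) := by
  rcases le_or_gt ‖mv s.A (z - s.c)‖ 1 with h | h
  · rw [update_of_norm_le h]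
    exact Set.subset_union_left.trans (subset_convexHull ℝ _)
  · intro y hy
    have hv := hU.validGrowth s.α _ hα hα2 h
    have hx := hU.axis_add s.α _ hα hα2 h
    have hα' := hv.alphaPar_pos
    rw [Rounding.mem_inner (by rw [update_alpha h]; exact hα'), update_alpha h] at hy
    have hy2 := pow_le_pow_left₀ (norm_nonneg _) hy 2
    rw [norm_update_sq hA h] at hy2
    obtain ⟨l, hl0, hl1, hl⟩ := hv.exists_weight rfl hx h (inner_sq_le (norm_normalize h)) hy2
    set u := mv s.A (z - s.c) with hu
    set p := mv s.A (y - s.c) with hp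
    have hu0 : 0 < ‖u‖ := by linarith
    have hl2 : 0 < 1 - l := by linarith
    have hpl : ‖p - l • u‖ ≤ (1 - l) * s.α := by
      apply le_of_sq_le_sq _ (by positivity)
      rw [mul_pow]
      refine le_trans (le_of_eq ?_) hl
      rw [norm_sub_sq_real, inner_smul_right, norm_smul, real_inner_smul_left,
        real_inner_comm u p, Real.norm_eq_abs, mul_pow, sq_abs]
      field_simp
    -- The solution of `y = (1 - l) q + l z`. The bound `hpl` says precisely that it lies in the old
    -- inner ellipsoid.
    set q : Vec d := s.c + (1 - l)⁻¹ • ((y - s.c) - l • (z - s.c)) with hq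
    have hqin : q ∈ s.inner := by
      rw [Rounding.mem_inner hα, hq, add_sub_cancel_left, mv_smul, mv_sub, mv_smul, norm_smul,
        ← hu, ← hp, norm_inv, Real.norm_of_nonneg hl2.le, inv_mul_le_iff₀ hl2]
      exact hpl
    have e : y = (1 - l) • q + l • z := by
      rw [hq, smul_add, smul_smul, mul_inv_cancel₀ hl2.ne']
      module
    rw [e]
    exact convex_convexHull ℝ _ (subset_convexHull ℝ (s.inner ∪ {z}) (Or.inl hqin))
      (subset_convexHull ℝ (s.inner ∪ {z}) (Or.inr rfl)) hl2.le hl0 (by ring)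

/-- What an update preserves in the second phase. -/
theorem update_bounds (hU : U.IsValid) (hd : 1 ≤ d) (hA : IsUnit s.A.det) (hα : 0 < s.α)
    (hα2 : s.α ≤ 1 / 2) :
    IsUnit (U.update s z).A.det ∧ 0 < (U.update s z).α ∧ (U.update s z).α ≤ s.α ∧
      1 / (U.update s z).α + 2 * Real.log |(U.update s z).A.det| ≤
        1 / s.α + 2 * Real.log |s.A.det| := by
  rcases le_or_gt ‖mv s.A (z - s.c)‖ 1 with h | h
  · rw [update_of_norm_le h]
    exact ⟨hA, hα, le_rfl, le_rfl⟩
  · have hv := hU.validGrowth s.α _ hα hα2 h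
    rw [update_det hd hv h, update_alpha h]
    have hb := hv.one_le_bPar
    have ha := hv.one_le
    -- The long axis alone pays for the increase `2γ` of `1/α`; the other `d - 1` axes have `b ≥ 1`
    -- and only decrease the potential further.
    have hlog : U.growth s.α ‖mv s.A (z - s.c)‖ ≤ Real.log (U.axis s.α ‖mv s.A (z - s.c)‖) := by
      rw [Real.le_log_iff_exp_le (by linarith)]
      exact hv.exp_le
    have hα' := hv.alphaPar_pos
    have hα'' := hv.alphaPar_le
    have hinv : 1 / alphaPar s.α (U.growth s.α ‖mv s.A (z - s.c)‖) =
        1 / s.α + 2 * U.growth s.α ‖mv s.A (z - s.c)‖ := by rw [alphaPar, one_div_one_div]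
    set γ := U.growth s.α ‖mv s.A (z - s.c)‖
    set a := U.axis s.α ‖mv s.A (z - s.c)‖
    set b := bPar s.α γ
    have hb0 : (1 / b) ^ (d - 1) ≠ 0 := by positivity
    have ha0 : 1 / a ≠ 0 := by positivity
    refine ⟨(isUnit_iff_ne_zero.2 (mul_ne_zero hb0 ha0)).mul hA, hα', hα'', ?_⟩
    rw [hinv, abs_mul, abs_mul, Real.log_mul (mul_ne_zero (abs_ne_zero.2 hb0) (abs_ne_zero.2 ha0))
      (abs_ne_zero.2 hA.ne_zero), Real.log_mul (abs_ne_zero.2 hb0) (abs_ne_zero.2 ha0),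
      Real.log_abs, Real.log_abs, Real.log_pow, one_div b, one_div a, Real.log_inv, Real.log_inv]
    have := mul_nonneg (Nat.cast_nonneg (α := ℝ) (d - 1)) (Real.log_nonneg hb)
    linarith

end UpdateRule

/-! ### The circumradius -/

section Circumradius

variable {d : ℕ}

theorem isBounded_hull (z : ℕ → Vec d) (t : ℕ) : Bornology.IsBounded (hull z t) :=
  isBounded_convexHull.2 ((Set.finite_Iio t).image z).isBounded

theorem le_circumradius {K : Set (Vec d)} (hK : Bornology.IsBounded K) {m : ℝ}
    (h : ∀ R : ℝ, 0 ≤ R → ∀ c : Vec d, K ⊆ Metric.closedBall c R → m ≤ R) :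
    m ≤ circumradius K := by
  apply le_csInf
  · obtain ⟨R, hR⟩ := (Metric.isBounded_iff_subset_closedBall (0 : Vec d)).1 hK
    exact ⟨max R 0, le_max_right _ _, 0,
      hR.trans (Metric.closedBall_subset_closedBall (le_max_left _ _))⟩
  · rintro R ⟨h0, c, hc⟩
    exact h R h0 c hc

/-- The point of the ball opposite to `p` is at distance `‖p - c₀‖ + r₀` from `p`, and no ball
contains two points farther apart than its diameter. -/
theorem add_div_two_le_circumradius {K : Set (Vec d)} (hK : Bornology.IsBounded K) {c₀ p : Vec d}
    {r₀ : ℝ} (hr : 0 ≤ r₀) (hp : p ∈ K) (hball : Metric.closedBall c₀ r₀ ⊆ K) (hpc : p ≠ c₀) :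
    (‖p - c₀‖ + r₀) / 2 ≤ circumradius K := by
  apply le_circumradius hK
  intro R _ c hc
  have hn : 0 < ‖p - c₀‖ := norm_pos_iff.2 (sub_ne_zero.2 hpc)
  set q : Vec d := c₀ - (r₀ / ‖p - c₀‖) • (p - c₀) with hq
  have hqK : q ∈ K := by
    apply hball
    rw [mem_closedBall_iff_norm, hq, sub_sub_cancel_left, norm_neg, norm_smul, norm_div, norm_norm,
      div_mul_cancel₀ _ hn.ne', Real.norm_of_nonneg hr]
  have h1 := mem_closedBall_iff_norm.1 (hc hp)
  have h2 := mem_closedBall_iff_norm.1 (hc hqK)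
  have h3 : ‖p - q‖ = ‖p - c₀‖ + r₀ := by
    have : p - q = (1 + r₀ / ‖p - c₀‖) • (p - c₀) := by rw [hq]; module
    rw [this, norm_smul, Real.norm_of_nonneg (by positivity), add_mul, one_mul,
      div_mul_cancel₀ _ hn.ne']
  have h4 : ‖p - q‖ ≤ ‖p - c‖ + ‖q - c‖ := by
    rw [← sub_sub_sub_cancel_right p q c]
    exact norm_sub_le _ _
  linarith

end Circumradius

/-! ### Balls as roundings -/

section Balls

variable {d : ℕ} {c : Vec d} {ρ α : ℝ}

theorem ballRounding_outer (hρ : 0 < ρ) : (ballRounding c ρ α).outer = Metric.closedBall c ρ := by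
  ext y
  rw [Rounding.mem_outer, ballRounding, mv_smul_one, norm_smul, mem_closedBall_iff_norm,
    Real.norm_of_nonneg (by positivity), one_div, inv_mul_le_iff₀ hρ, mul_one]

theorem ballRounding_inner (hρ : 0 < ρ) (hα : 0 < α) :
    (ballRounding c ρ α).inner = Metric.closedBall c (ρ * α) := by
  ext y
  rw [Rounding.mem_inner (by exact hα), ballRounding, mv_smul_one, norm_smul,
    mem_closedBall_iff_norm, Real.norm_of_nonneg (by positivity), one_div, inv_mul_le_iff₀ hρ]

theorem ballRounding_det : (ballRounding c ρ α).A.det = (1 / ρ) ^ d := by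
  simp [ballRounding]

theorem isUnit_ballRounding_det (hρ : 0 < ρ) : IsUnit (ballRounding c ρ α).A.det := by
  rw [ballRounding_det]
  exact isUnit_iff_ne_zero.2 (by positivity)

end Balls

/-! ### The two-phase algorithm for an update rule -/

theorem two_le_threshold (d : ℕ) : 2 ≤ threshold d := le_max_left _ _

namespace UpdateRule

/-- Processing the point `z`. -/
noncomputable def step (U : UpdateRule) {d : ℕ} (c₀ : Vec d) (r₀ : ℝ) (s : AlgState d)
    (z : Vec d) : AlgState d :=
  if s.phaseII = true then
    { s with out := U.update s.out z }
  else if ‖z - c₀‖ ≤ r₀ * threshold d then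
    if r₀ * s.R < ‖z - c₀‖ then
      { phaseII := false
        R := ‖z - c₀‖ / r₀
        out := ballRounding c₀ ‖z - c₀‖ (r₀ / ‖z - c₀‖) }
    else s
  else
    { phaseII := true
      R := s.R
      out := U.update (ballRounding c₀ (r₀ * threshold d) (1 / threshold d)) z }

/-- The state after the first `t` points of the stream `z`. -/
noncomputable def state (U : UpdateRule) {d : ℕ} (c₀ : Vec d) (r₀ : ℝ) (z : ℕ → Vec d) :
    ℕ → AlgState d
  | 0 => algInit c₀ r₀
  | t + 1 => U.step c₀ r₀ (U.state c₀ r₀ z t) (z t)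

/-- The invariant of the algorithm. -/
def Invariant {d : ℕ} (c₀ : Vec d) (r₀ : ℝ) (z : ℕ → Vec d) (t : ℕ) (s : AlgState d) : Prop :=
  (s.phaseII = false ∧ s.out = ballRounding c₀ (r₀ * s.R) (1 / s.R) ∧ 1 ≤ s.R ∧
    s.R ≤ threshold d ∧ (s.R = 1 ∨ ∃ i < t, ‖z i - c₀‖ = r₀ * s.R)) ∨
  (s.phaseII = true ∧ IsUnit s.out.A.det ∧ 0 < s.out.α ∧ s.out.α ≤ 1 / 2 ∧
    1 / s.out.α + 2 * Real.log |s.out.A.det| ≤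
      threshold d - 2 * (d * Real.log (r₀ * threshold d)) ∧
    ∃ i < t, r₀ * threshold d < ‖z i - c₀‖)

variable {U : UpdateRule} {d : ℕ} {c₀ : Vec d} {r₀ : ℝ} {z : ℕ → Vec d} {s : AlgState d} {t : ℕ}

theorem Invariant.isUnit (h : Invariant c₀ r₀ z t s) (hr : 0 < r₀) : IsUnit s.out.A.det := by
  rcases h with ⟨-, h, h1, -⟩ | ⟨-, h, -⟩
  · rw [h]
    exact isUnit_ballRounding_det (by positivity)
  · exact h

theorem Invariant.alpha_mem (h : Invariant c₀ r₀ z t s) : 0 < s.out.α ∧ s.out.α ≤ 1 := by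
  rcases h with ⟨-, h, h1, -⟩ | ⟨-, -, h1, h2, -⟩
  · rw [h]
    exact ⟨show 0 < 1 / s.R by positivity, show 1 / s.R ≤ 1 from (div_le_one (by linarith)).2 h1⟩
  · exact ⟨h1, by linarith⟩

theorem invariant_init : Invariant c₀ r₀ z 0 (algInit c₀ r₀) := by
  left
  refine ⟨rfl, ?_, le_rfl, ?_, Or.inl rfl⟩
  · simp [algInit]
  · exact le_trans (by simp [algInit]) (two_le_threshold d)

theorem alpha_threshold_le : 1 / threshold d ≤ 1 / 2 :=
  one_div_le_one_div_of_le two_pos (two_le_threshold d)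

theorem invariant_step (hU : U.IsValid) (hd : 1 ≤ d) (hr : 0 < r₀)
    (h : Invariant c₀ r₀ z t s) : Invariant c₀ r₀ z (t + 1) (U.step c₀ r₀ s (z t)) := by
  have hT := two_le_threshold d
  rcases h with ⟨h1, h2, h3, h4, h5⟩ | ⟨h1, h2, h3, h4, h5, i, hi, h6⟩
  · by_cases hz : ‖z t - c₀‖ ≤ r₀ * threshold d
    · by_cases hR : r₀ * s.R < ‖z t - c₀‖
      · left
        simp only [step, h1, Bool.false_eq_true, if_false, hz, hR, if_true, true_and]
        have e : r₀ * (‖z t - c₀‖ / r₀) = ‖z t - c₀‖ := by field_simp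
        refine ⟨by rw [e, one_div_div], ?_, ?_, Or.inr ⟨t, by omega, e.symm⟩⟩
        · rw [le_div_iff₀ hr]; nlinarith
        · rw [div_le_iff₀ hr]; linarith
      · left
        simp only [step, h1, Bool.false_eq_true, if_false, hz, hR, if_true]
        refine ⟨trivial, h2, h3, h4, h5.imp_right ?_⟩
        rintro ⟨i, hi, e⟩
        exact ⟨i, by omega, e⟩
    · right
      simp only [step, h1, Bool.false_eq_true, if_false, hz, true_and]
      have hρ : 0 < r₀ * threshold d := by positivity
      -- At the switch the potential of the ball of radius `r₀ T` with factor `1/T` is exactly `T -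
      -- 2 d log (r₀ T)`.
      obtain ⟨g1, g2, g3, g4⟩ := update_bounds (z := z t) hU hd
        (isUnit_ballRounding_det (c := c₀) (α := 1 / threshold d) hρ)
        (show 0 < 1 / threshold d by positivity) alpha_threshold_le
      refine ⟨g1, g2, g3.trans alpha_threshold_le, g4.trans (le_of_eq ?_), t, by omega,
        not_le.1 hz⟩
      rw [ballRounding_det, abs_of_pos (by positivity), Real.log_pow, one_div (r₀ * _),
        Real.log_inv]
      simp only [ballRounding, one_div_one_div]
      ring
  · right
    simp only [step, h1, if_true, true_and]
    obtain ⟨g1, g2, g3, g4⟩ := update_bounds (z := z t) hU hd h2 h3 h4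
    exact ⟨g1, g2, g3.trans h4, g4.trans h5, i, by omega, h6⟩

theorem monotone_step (hU : U.IsValid) (hr : 0 < r₀)
    (h : Invariant c₀ r₀ z t s) :
    s.out.outer ⊆ (U.step c₀ r₀ s (z t)).out.outer ∧ z t ∈ (U.step c₀ r₀ s (z t)).out.outer ∧
      (U.step c₀ r₀ s (z t)).out.inner ⊆ convexHull ℝ (s.out.inner ∪ {z t}) := by
  have hT := two_le_threshold d
  rcases h with ⟨h1, h2, h3, h4, h5⟩ | ⟨h1, h2, h3, h4, h5, i, hi, h6⟩
  · have hρ : 0 < r₀ * s.R := by positivity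
    have hin : s.out.inner = Metric.closedBall c₀ r₀ := by
      rw [h2, ballRounding_inner hρ (by positivity)]
      congr 1
      field_simp
    have hout : s.out.outer = Metric.closedBall c₀ (r₀ * s.R) := by rw [h2, ballRounding_outer hρ]
    by_cases hz : ‖z t - c₀‖ ≤ r₀ * threshold d
    · by_cases hR : r₀ * s.R < ‖z t - c₀‖
      · simp only [step, h1, Bool.false_eq_true, if_false, hz, hR, if_true]
        have hz0 : 0 < ‖z t - c₀‖ := by linarith
        rw [hin, hout, ballRounding_outer hz0, ballRounding_inner hz0 (by positivity)]
        refine ⟨Metric.closedBall_subset_closedBall hR.le, mem_closedBall_iff_norm.2 le_rfl, ?_⟩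
        have : ‖z t - c₀‖ * (r₀ / ‖z t - c₀‖) = r₀ := by field_simp
        rw [this]
        exact Set.subset_union_left.trans (subset_convexHull ℝ _)
      · simp only [step, h1, Bool.false_eq_true, if_false, hz, hR, if_true]
        refine ⟨subset_rfl, ?_, Set.subset_union_left.trans (subset_convexHull ℝ _)⟩
        rw [hout]
        exact mem_closedBall_iff_norm.2 (not_lt.1 hR)
    · simp only [step, h1, Bool.false_eq_true, if_false, hz]
      have hρT : 0 < r₀ * threshold d := by positivity
      have hA := isUnit_ballRounding_det (c := c₀) (α := 1 / threshold d) hρT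
      have hα : 0 < 1 / threshold d := by positivity
      -- Passing to the ball of radius `r₀ T` with factor `1/T` enlarges the outer ball and leaves
      -- the inner ball of radius `r₀` as it is, so the switch preserves both inclusions.
      refine ⟨?_, mem_update_outer hU hA hα alpha_threshold_le, ?_⟩
      · refine subset_trans ?_ (outer_subset_update hU hA hα alpha_threshold_le)
        rw [hout, ballRounding_outer hρT]
        exact Metric.closedBall_subset_closedBall (by gcongr)
      · refine (update_inner_subset hU hA hα alpha_threshold_le).trans (le_of_eq ?_)
        rw [hin, ballRounding_inner hρT hα]
        congr 3
        field_simp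
  · simp only [step, h1, if_true]
    exact ⟨outer_subset_update hU h2 h3 h4, mem_update_outer hU h2 h3 h4,
      update_inner_subset hU h2 h3 h4⟩

end UpdateRule

/-! ### The approximation factor -/

section Approximation

/-- For `d ≥ 3` one has `log d ≥ 1`, so `d ≤ T ≤ 2y - 1`; for `d ≤ 2` already `(3/2)³ ≥ 2`. It is
used in the form `log d ≤ 3 log y`. -/
theorem le_cube_of_threshold {d : ℕ} {y : ℝ} (hy : (threshold d + 1) / 2 ≤ y) :
    (d : ℝ) ≤ y ^ 3 := by
  have h1 : 3 / 2 ≤ y := by linarith [two_le_threshold d]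
  have h2 : (9 / 4 : ℝ) ≤ y ^ 2 := by nlinarith
  rcases le_or_gt d 2 with h | h
  · have : (d : ℝ) ≤ 2 := by exact_mod_cast h
    nlinarith
  · have h3 : (3 : ℝ) ≤ d := by exact_mod_cast h
    have h4 : 1 ≤ Real.log d := by
      rw [Real.le_log_iff_exp_le (by linarith)]
      linarith [Real.exp_one_lt_d9]
    have h5 : (d : ℝ) ≤ threshold d :=
      le_trans (by nlinarith) (le_max_right _ _)
    nlinarith

theorem third_le_log {y : ℝ} (hy : 3 / 2 ≤ y) : 1 / 3 ≤ Real.log y := by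
  have h0 : 0 < y := by linarith
  have := Real.one_sub_inv_le_log_of_pos h0
  have h2 : y⁻¹ ≤ 2 / 3 := by
    rw [inv_le_comm₀ h0 (by norm_num)]
    linarith
  linarith

theorem log_le_three_mul_log {x y : ℝ} (hx : 0 < x) (h : x ≤ y ^ 3) :
    Real.log x ≤ 3 * Real.log y := by
  have := Real.log_le_log hx h
  rwa [Real.log_pow] at this

theorem firstPhase_factor_le {d : ℕ} {x y : ℝ} (hxT : x ≤ threshold d)
    (hy : x ≤ 1 ∨ (x + 1) / 2 ≤ y) : x ≤ 200 * max 1 (min y (d * Real.log y)) := by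
  rcases le_or_gt x 2 with h2 | h2
  · have := le_max_left 1 (min y (d * Real.log y))
    linarith
  · replace hy : (x + 1) / 2 ≤ y := hy.resolve_left (by linarith)
    have hxd : x ≤ d * Real.log d := (le_max_iff.1 hxT).resolve_left (by linarith)
    have h1 : 3 / 2 ≤ y := by linarith
    have hl := third_le_log h1
    have hd0 : (0 : ℝ) ≤ d := Nat.cast_nonneg d
    have key : x ≤ 3 * (d * Real.log y) := by
      rcases le_or_gt x d with hxd' | hxd'
      · nlinarith
      · have hy3 : x ≤ y ^ 3 := by
          have : (9 / 4 : ℝ) ≤ y ^ 2 := by nlinarith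
          nlinarith
        have hlx := log_le_three_mul_log (by linarith) hy3
        have hd1 : 0 < (d : ℝ) := by
          rcases hd0.eq_or_lt with h | h
          · rw [← h] at hxd; linarith
          · exact h
        have : Real.log d ≤ Real.log x := Real.log_le_log hd1 hxd'.le
        nlinarith
    have : x ≤ 200 * min y (d * Real.log y) := by
      rw [mul_min_of_nonneg _ _ (by norm_num)]
      apply le_min <;> nlinarith
    exact this.trans (by gcongr; exact le_max_right _ _)

/-- The term `2 d log x` is absorbed into `x/2` at the price of `O(d log d)`. All remaining terms
are multiples of `d log y`, which gives `x ≤ 64 d log y`; with `d log y ≤ 3y` also `x ≤ 192 y`. -/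
theorem secondPhase_factor_le {d : ℕ} (hd : 1 ≤ d) {x y : ℝ} (hx0 : 0 < x)
    (hy : (threshold d + 1) / 2 ≤ y)
    (h : x ≤ threshold d + 2 * (d * Real.log y) + 2 * (d * Real.log x)) :
    x ≤ 200 * max 1 (min y (d * Real.log y)) := by
  have hT := two_le_threshold d
  have hTd : d * Real.log d ≤ threshold d := le_max_right _ _
  have hd1 : (1 : ℝ) ≤ d := by exact_mod_cast hd
  have h1 : 3 / 2 ≤ y := by linarith
  have hl := third_le_log h1
  have hcube := log_le_three_mul_log (by linarith) (le_cube_of_threshold hy)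
  have hTy : threshold d ≤ 6 * (d * Real.log y) := by
    apply max_le <;> nlinarith
  have hdy : (d : ℝ) ≤ 3 * (d * Real.log y) := by nlinarith
  have hlogx : d * Real.log x ≤ x / 4 + 2 * d + d * Real.log d := by
    -- The divisor `4d` makes `d log (x / (4d))` at most `x/4 - d`. The constant `2` is this `-1`
    -- together with `log 4 ≤ 3`.
    have e : Real.log x = Real.log (x / (4 * d)) + Real.log 4 + Real.log d := by
      rw [Real.log_div hx0.ne' (by positivity), Real.log_mul (by norm_num) (by positivity)]
      ring
    have l1 := Real.log_le_sub_one_of_pos (show 0 < x / (4 * d) by positivity)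
    have l2 := Real.log_le_sub_one_of_pos (show (0 : ℝ) < 4 by norm_num)
    have : d * Real.log x ≤ d * (x / (4 * d) + 2 + Real.log d) := by
      apply mul_le_mul_of_nonneg_left _ (by linarith)
      linarith
    refine this.trans (le_of_eq ?_)
    field_simp
  have k1 : x ≤ 64 * (d * Real.log y) := by linarith
  have k2 : d * Real.log y ≤ 3 * y := by
    have e : Real.log y = Real.log (y / d) + Real.log d := by
      rw [Real.log_div (by linarith) (by positivity)]
      ring
    have l1 := Real.log_le_sub_one_of_pos (show 0 < y / d by positivity)
    have : d * Real.log y ≤ d * (y / d + Real.log d) := by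
      apply mul_le_mul_of_nonneg_left _ (by linarith)
      linarith
    have e2 : d * (y / d + Real.log d) = y + d * Real.log d := by field_simp
    linarith
  have : x ≤ 200 * min y (d * Real.log y) := by
    rw [mul_min_of_nonneg _ _ (by norm_num)]
    apply le_min <;> nlinarith
  exact this.trans (by gcongr; exact le_max_right _ _)

end Approximation

/-! ### The guarantee -/

namespace UpdateRule

variable {U : UpdateRule} {d : ℕ} {c₀ : Vec d} {r₀ : ℝ} {z : ℕ → Vec d}

theorem invariant_state (hU : U.IsValid) (hd : 1 ≤ d) (hr : 0 < r₀) (t : ℕ) :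
    Invariant c₀ r₀ z t (U.state c₀ r₀ z t) := by
  induction t with
  | zero => exact invariant_init
  | succ t ih => exact invariant_step hU hd hr ih

theorem Invariant.factor_le {s : AlgState d} {n : ℕ} (hd : 1 ≤ d) (hr : 0 < r₀)
    (h : Invariant c₀ r₀ z n s) (hball : Metric.closedBall c₀ r₀ ⊆ hull z n)
    (hin : s.out.inner ⊆ hull z n) :
    1 / s.out.α ≤ 200 * max 1 (min (circumradius (hull z n) / r₀)
      (d * Real.log (circumradius (hull z n) / r₀))) := by
  have hT := two_le_threshold d
  have hmem : ∀ i < n, z i ∈ hull z n := fun i hi =>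
    subset_convexHull ℝ _ (Set.mem_image_of_mem z hi)
  have hrad : ∀ i < n, 0 < ‖z i - c₀‖ →
      (‖z i - c₀‖ / r₀ + 1) / 2 ≤ circumradius (hull z n) / r₀ := by
    intro i hi h0
    have := add_div_two_le_circumradius (isBounded_hull z n) hr.le (hmem i hi) hball
      (sub_ne_zero.1 (norm_pos_iff.1 h0))
    rw [le_div_iff₀ hr]
    calc _ = (‖z i - c₀‖ + r₀) / 2 := by field_simp
      _ ≤ _ := this
  rcases h with ⟨-, h2, h3, h4, h5⟩ | ⟨-, h2, h3, -, h5, i, hi, h6⟩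
  · have hα : 1 / s.out.α = s.R := by
      rw [h2]
      exact one_div_one_div _
    rw [hα]
    apply firstPhase_factor_le h4
    rcases h5 with h5 | ⟨i, hi, h5⟩
    · exact Or.inl h5.le
    · right
      have := hrad i hi (by rw [h5]; positivity)
      rwa [h5, mul_div_cancel_left₀ _ hr.ne'] at this
  · have hρ : 0 < r₀ * threshold d := by positivity
    have hy : (threshold d + 1) / 2 ≤ circumradius (hull z n) / r₀ := by
      refine le_trans ?_ (hrad i hi (hρ.trans h6))
      have : threshold d ≤ ‖z i - c₀‖ / r₀ := by rw [le_div_iff₀ hr]; linarith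
      linarith
    have hy0 : 0 < circumradius (hull z n) / r₀ := by linarith
    have hcirc : 0 < circumradius (hull z n) := (div_pos_iff_of_pos_right hr).1 hy0
    have hd0 : (0 : ℝ) < d := by exact_mod_cast hd
    have hdet : 0 < |s.out.A.det| := abs_pos.2 h2.ne_zero
    -- The `d`-th root of `α^d / |det A|`, the volume radius of the inner ellipsoid. It is at most
    -- the radius of every ball containing the hull, hence at most the infimum of these radii.
    set m := Real.exp ((-Real.log |s.out.A.det| + d * Real.log s.out.α) / d) with hm
    have hmd : m ^ d = |s.out.A.det|⁻¹ * s.out.α ^ d := by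
      rw [hm, ← Real.exp_nat_mul, mul_div_cancel₀ _ hd0.ne', Real.exp_add, Real.exp_neg,
        Real.exp_log hdet, Real.exp_nat_mul, Real.exp_log h3]
    have hmR : m ≤ circumradius (hull z n) := by
      apply le_circumradius (isBounded_hull z n)
      intro R hR c hc
      have := Rounding.abs_det_inv_mul_pow_le h2 h3 hR (hin.trans hc)
      rw [← hmd] at this
      exact (pow_le_pow_iff_left₀ (Real.exp_pos _).le hR (by omega)).1 this
    have hlog := (Real.le_log_iff_exp_le hcirc).2 hmR
    rw [div_le_iff₀ hd0] at hlog
    apply secondPhase_factor_le hd (by positivity) hy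
    rw [Real.log_div hcirc.ne' hr.ne', one_div, Real.log_inv, ← one_div]
    rw [Real.log_mul hr.ne' (by linarith)] at h5
    have hlT : 0 ≤ d * Real.log (threshold d) :=
      mul_nonneg hd0.le (Real.log_nonneg (by linarith))
    linarith

theorem IsValid.guarantee (hU : U.IsValid) (hd : 1 ≤ d) (hr : 0 < r₀) {C : ℝ} (hC : 200 ≤ C) :
    Guarantee C c₀ r₀ z (fun t => (U.state c₀ r₀ z t).out) := by
  have hinv := invariant_state (c₀ := c₀) (r₀ := r₀) (z := z) hU hd hr
  have hmono := fun t => monotone_step hU hr (hinv t)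
  have hcov : ∀ t, hull z t ⊆ (U.state c₀ r₀ z t).out.outer := by
    intro t
    apply convexHull_min _ Rounding.convex_outer
    induction t with
    | zero => simp
    | succ t ih =>
      rintro _ ⟨i, hi, rfl⟩
      rcases (Nat.lt_succ_iff_lt_or_eq.1 hi) with h | rfl
      · exact (hmono t).1 (ih (Set.mem_image_of_mem z h))
      · exact (hmono i).2.1
  have hinit : (U.state c₀ r₀ z 0).out = ballRounding c₀ r₀ 1 := rfl
  refine ⟨?_, ?_, fun t => (hinv t).isUnit hr, fun t => (hinv t).alpha_mem, fun t => ?_,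
    fun t => (hmono t).2.2, hcov, fun n hball => ?_⟩
  · rw [hinit, ballRounding_outer hr]
  · rw [hinit, ballRounding]
  · apply convexHull_min _ Rounding.convex_outer
    exact Set.union_subset (hmono t).1 (Set.singleton_subset_iff.2 (hmono t).2.1)
  · have hin : (U.state c₀ r₀ z n).out.inner ⊆ hull z n := by
      -- The induction stays inside the final hull: it contains the initial ball by assumption, all
      -- points up to `n`, and is convex.
      have : ∀ t ≤ n, (U.state c₀ r₀ z t).out.inner ⊆ hull z n := by
        intro t
        induction t with
        | zero =>
          intro _
          rw [hinit, ballRounding_inner hr one_pos, mul_one]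
          exact hball
        | succ t ih =>
          intro ht
          refine (hmono t).2.2.trans (convexHull_min ?_ (convex_convexHull ℝ _))
          exact Set.union_subset (ih (by omega)) (Set.singleton_subset_iff.2
            (subset_convexHull ℝ _ (Set.mem_image_of_mem z (by simpa using ht))))
      exact this n le_rfl
    refine ⟨hin, hcov n, ((hinv n).factor_le hd hr hball hin).trans ?_⟩
    gcongr

end UpdateRule

/-! ### Two update rules -/

/-- The update rule with the root `γ`. -/
noncomputable def rootRule : UpdateRule where
  growth := gammaStar
  axis := fun α x => aPar (gammaStar α x)

/-- An update rule in closed form. -/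
noncomputable def logRule : UpdateRule where
  growth := fun α x => Real.log ((x + α) / (1 + α))
  axis := fun α x => (x + α) / (1 + alphaPar α (Real.log ((x + α) / (1 + α))))

/-- The function `a(γ) + c'(γ)` is `1` at `0` and at least `x` at `x + α`. The set of roots is
nonempty, closed and bounded below, so its infimum is a root; uniqueness plays no role. -/
theorem gammaStar_spec {α x : ℝ} (hα : 0 < α) (hx : 1 < x) :
    0 ≤ gammaStar α x ∧ aPar (gammaStar α x) + cPar α (gammaStar α x) = x := by
  set f : ℝ → ℝ := fun γ => aPar γ + cPar α γ with hf
  have hcont : ContinuousOn f (Set.Ici 0) := by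
    have hne : ∀ γ ∈ Set.Ici (0 : ℝ), 1 / α + 2 * γ ≠ 0 := by
      intro γ hγ
      have : (0 : ℝ) ≤ γ := hγ
      positivity
    simp only [hf, aPar, cPar, alphaPar]
    fun_prop (disch := assumption)
  have hclosed : IsClosed {γ : ℝ | 0 ≤ γ ∧ aPar γ + cPar α γ = x} := by
    have := hcont.preimage_isClosed_of_isClosed isClosed_Ici (isClosed_singleton (x := x))
    convert this using 1
    ext γ
    simp [hf]
  have hne : {γ : ℝ | 0 ≤ γ ∧ aPar γ + cPar α γ = x}.Nonempty := by
    have h0 : f 0 = 1 := by simp [hf, aPar, cPar, alphaPar]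
    have hb : 0 ≤ x + α := by linarith
    have h1 : x ≤ f (x + α) := by
      have h2 : 0 ≤ alphaPar α (x + α) * aPar (x + α) := by
        unfold alphaPar aPar
        positivity
      have := Real.add_one_le_exp (x + α)
      simp only [hf, cPar]
      unfold aPar at *
      linarith
    have := intermediate_value_Icc hb (hcont.mono Set.Icc_subset_Ici_self)
    obtain ⟨γ, hγ, e⟩ := this ⟨by rw [h0]; exact hx.le, h1⟩
    exact ⟨γ, hγ.1, e⟩
  exact hclosed.csInf_mem hne ⟨0, fun γ h => h.1⟩

theorem rootRule_isValid : rootRule.IsValid where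
  validGrowth := by
    intro α x hα hα2 hx
    obtain ⟨h0, -⟩ := gammaStar_spec hα hx
    change ValidGrowth α (gammaStar α x) (Real.exp (gammaStar α x))
    refine ⟨hα, hα2, h0, le_rfl, ?_⟩
    have h1 := exp_mul_one_sub_le_one (gammaStar α x)
    have h2 := alphaPar_pos hα h0
    have h3 := alphaPar_le_self hα h0
    refine h1.trans ?_
    rw [le_div_iff₀ (by linarith)]
    linarith
  axis_add := by
    intro α x hα _ hx
    have := (gammaStar_spec hα hx).2
    simp only [rootRule]
    rw [cPar] at this
    linarith

/-- Touching the new point means `a = (x + α)/(1 + α')`, which is explicit once `γ` is known. With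
`exp γ = (x + α)/(1 + α)`, `exp_le` follows from `α' ≤ α`, and `le_one_add` from `exp γ (1 - γ) ≤
1`. -/
theorem logRule_isValid : logRule.IsValid where
  validGrowth := by
    intro α x hα hα2 hx
    have hq : 1 ≤ (x + α) / (1 + α) := by
      rw [le_div_iff₀ (by linarith)]
      linarith
    have h0 : 0 ≤ Real.log ((x + α) / (1 + α)) := Real.log_nonneg hq
    change ValidGrowth α (Real.log ((x + α) / (1 + α)))
      ((x + α) / (1 + alphaPar α (Real.log ((x + α) / (1 + α)))))
    have hexp : Real.exp (Real.log ((x + α) / (1 + α))) = (x + α) / (1 + α) :=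
      Real.exp_log (by linarith)
    set γ := Real.log ((x + α) / (1 + α))
    have h2 := alphaPar_pos hα h0
    have h3 := alphaPar_le_self hα h0
    refine ⟨hα, hα2, h0, ?_, ?_⟩
    · rw [hexp]
      have : 0 ≤ x + α := by linarith
      gcongr
    · rw [div_mul_eq_mul_div]
      gcongr
      have e : x + α = (1 + α) * Real.exp γ := by rw [hexp]; field_simp
      have h1 := exp_mul_one_sub_le_one γ
      rw [e, mul_assoc]
      nlinarith
  axis_add := by
    intro α x hα _ hx
    have h0 : 0 ≤ Real.log ((x + α) / (1 + α)) := by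
      apply Real.log_nonneg
      rw [le_div_iff₀ (by linarith)]
      linarith
    simp only [logRule]
    have h2 := alphaPar_pos hα h0
    field_simp
    ring

theorem rootRule_state {d : ℕ} (c₀ : Vec d) (r₀ : ℝ) (z : ℕ → Vec d) (t : ℕ) :
    rootRule.state c₀ r₀ z t = algState c₀ r₀ z t := by
  induction t with
  | zero => rfl
  | succ t ih =>
    rw [UpdateRule.state, algState, ih]
    rfl

/-! ### Reasoning about programs -/

section Execution

variable {G : ℝ → ℝ → ℝ} {d M : ℕ} {inp : ℕ → ℝ} {σ : ℕ → ℕ} {m : Fin M → ℝ}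

theorem readCell_writeCell {i : ℕ} (hi : i < M) (x : ℝ) (k : ℕ) :
    readCell (writeCell m i x) k = if k = i then x else readCell m k := by
  by_cases hk : k < M
  · simp [readCell, writeCell, hk]
  · simp [readCell, hk, show k ≠ i by omega]

theorem exec_assign {e : NExpr} {x : RExpr} :
    ((Cmd.assign e x).exec G d inp σ m).1 =
      writeCell m (e.val d σ) (x.val G d inp σ m) := rfl

theorem exec_seq {p q : Cmd} :
    ((Cmd.seq p q).exec G d inp σ m).1 =
      (q.exec G d inp σ (p.exec G d inp σ m).1).1 := rfl

theorem exec_ifLe {x y : RExpr} {p q : Cmd} :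
    ((Cmd.ifLe x y p q).exec G d inp σ m).1 =
      if x.val G d inp σ m ≤ y.val G d inp σ m then (p.exec G d inp σ m).1
      else (q.exec G d inp σ m).1 := by
  rw [Cmd.exec]
  split_ifs <;> rfl

theorem exec_loop_induction {v : ℕ} {p : Cmd} (I : ℕ → (Fin M → ℝ) → Prop) (h0 : I 0 m)
    (hs : ∀ i < d, ∀ m', I i m' → I (i + 1) (p.exec G d inp (Function.update σ v i) m').1) :
    I d ((Cmd.loop v .dim p).exec G d inp σ m).1 := by
  have : ∀ n ≤ d, I n (passes (fun i m' => p.exec G d inp (Function.update σ v i) m')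
      (m, NExpr.cost .dim + 1) n).1 := by
    intro n
    induction n with
    | zero => exact fun _ => h0
    | succ n ih => exact fun hn => hs n (by omega) _ (ih (by omega))
  exact this d le_rfl

/-- A loop whose passes write to distinct cells. -/
theorem exec_loop_scatter {v : ℕ} {p : Cmd} (addr : ℕ → ℕ) (X : ℕ → ℝ)
    (hinj : ∀ i < d, ∀ j < d, addr i = addr j → i = j)
    (hbody : ∀ i < d, ∀ m' : Fin M → ℝ,
      (∀ k, (∀ j < i, k ≠ addr j) → readCell m' k = readCell m k) →
      ∀ k, readCell (p.exec G d inp (Function.update σ v i) m').1 k =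
        if k = addr i then X i else readCell m' k) :
    (∀ i < d, readCell ((Cmd.loop v .dim p).exec G d inp σ m).1 (addr i) = X i) ∧
      ∀ k, (∀ i < d, k ≠ addr i) →
        readCell ((Cmd.loop v .dim p).exec G d inp σ m).1 k = readCell m k := by
  refine And.imp_left (fun h i hi => h i hi hi) (exec_loop_induction
    (I := fun n m' => (∀ i < n, i < d → readCell m' (addr i) = X i) ∧
      ∀ k, (∀ i < n, k ≠ addr i) → readCell m' k = readCell m k) ?_ ?_)
  · exact ⟨fun i hi => absurd hi (Nat.not_lt_zero i), fun _ _ => rfl⟩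
  · rintro i hi m' ⟨h1, h2⟩
    have hb := hbody i hi m' h2
    refine ⟨fun j hj hjd => ?_, fun k hk => ?_⟩
    · rw [hb]
      rcases Nat.lt_succ_iff_lt_or_eq.1 hj with h | rfl
      · rw [if_neg (fun e => h.ne (hinj j hjd i hi e)), h1 j h hjd]
      · rw [if_pos rfl]
    · rw [hb, if_neg (hk i (by omega))]
      exact h2 k fun j hj => hk j (by omega)

/-- Store the sum of `x` over the values of the loop counter `v` in the cell `e`. -/
def sumInto (v : ℕ) (e : NExpr) (x : RExpr) : Cmd :=
  .seq (.assign e (.nat (.lit 0))) (.loop v .dim (.assign e (.add (.mem e) x)))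

/-- The address must not depend on the summation counter, and the summand must not read the
accumulator: it is evaluated in memories that differ from `m` at `a` only. -/
theorem exec_sumInto {v : ℕ} {e : NExpr} {x : RExpr} {a : ℕ} (X : ℕ → ℝ) (ha : a < M)
    (he : e.val d σ = a) (hev : ∀ i, e.val d (Function.update σ v i) = a)
    (hx : ∀ i < d, ∀ m' : Fin M → ℝ, (∀ k ≠ a, readCell m' k = readCell m k) →
      x.val G d inp (Function.update σ v i) m' = X i) (k : ℕ) :
    readCell ((sumInto v e x).exec G d inp σ m).1 k =
      if k = a then ∑ i ∈ Finset.range d, X i else readCell m k := by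
  rw [sumInto, exec_seq, exec_assign, he]
  apply exec_loop_induction (I := fun n m' => ∀ k, readCell m' k =
    if k = a then ∑ i ∈ Finset.range n, X i else readCell m k)
  · intro k
    rw [readCell_writeCell ha]
    simp [RExpr.val, NExpr.val]
  · intro i hi m' h k
    rw [exec_assign, hev, readCell_writeCell ha]
    split_ifs with hk
    · rw [Finset.sum_range_succ, RExpr.val, RExpr.val, hev, h, if_pos rfl,
        hx i hi m' fun k hk => by rw [h, if_neg hk]]
    · rw [h, if_neg hk]

end Execution

/-! ### Costs -/

/-- Every loop runs over the coordinates. -/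
def Cmd.DimLoops : Cmd → Prop
  | .skip => True
  | .assign _ _ => True
  | .seq p q => p.DimLoops ∧ q.DimLoops
  | .ifLe _ _ p q => p.DimLoops ∧ q.DimLoops
  | .loop _ e p => e = .dim ∧ p.DimLoops

/-- An upper bound for the number of steps if every loop runs over the coordinates. -/
def Cmd.bound (d : ℕ) : Cmd → ℕ
  | .skip => 1
  | .assign e x => e.cost + x.cost + 1
  | .seq p q => p.bound d + q.bound d
  | .ifLe x y p q => x.cost + y.cost + (p.bound d + q.bound d) + 1
  | .loop _ e p => e.cost + 1 + d * (p.bound d + 1)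

/-- `Cmd.bound` charges both branches of every conditional, so it depends on the text and on `d`,
never on the data. -/
theorem Cmd.exec_cost_le {G : ℝ → ℝ → ℝ} {d M : ℕ} {inp : ℕ → ℝ} (p : Cmd) (hp : p.DimLoops)
    (σ : ℕ → ℕ) (m : Fin M → ℝ) : (p.exec G d inp σ m).2 ≤ p.bound d := by
  induction p generalizing σ m with
  | skip => exact le_rfl
  | assign e x => exact le_rfl
  | seq p q ihp ihq => exact add_le_add (ihp hp.1 _ _) (ihq hp.2 _ _)
  | ifLe x y p q ihp ihq =>
    simp only [Cmd.exec, Cmd.bound]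
    gcongr
    split_ifs
    · exact (ihp hp.1 _ _).trans (Nat.le_add_right _ _)
    · exact (ihq hp.2 _ _).trans (Nat.le_add_left _ _)
  | loop v e p ih =>
    obtain ⟨rfl, hp⟩ := hp
    have : ∀ n, (passes (fun i m' => p.exec G d inp (Function.update σ v i) m')
        (m, NExpr.cost .dim + 1) n).2 ≤ NExpr.cost .dim + 1 + n * (p.bound d + 1) := by
      intro n
      induction n with
      | zero => simp [passes]
      | succ n hn =>
        have := ih hp (Function.update σ v n)
          (passes (fun i m' => p.exec G d inp (Function.update σ v i) m')
            (m, NExpr.cost .dim + 1) n).1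
        simp only [passes]
        rw [add_mul]
        omega
    exact this d

/-! ### The program of an update rule -/

section Program

/-- The address of the `k`-th scalar in memory. -/
def scalar (d k : ℕ) : ℕ := d * d + (d + k)

/-- The address of the `k`-th scalar, as an expression. -/
def scalarE (k : ℕ) : NExpr := .add (.mul .dim .dim) (.add .dim (.lit k))

/-- The content of the `k`-th scalar. -/
def getS (k : ℕ) : RExpr := .mem (scalarE k)

/-- Write to the `k`-th scalar. -/
def setS (k : ℕ) (x : RExpr) : Cmd := .assign (scalarE k) x

/-- The address of a matrix entry. -/
def entryE (v v' : ℕ) : NExpr := .add (.mul (.var v) .dim) (.var v')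

/-- The address of a coordinate of the center. -/
def centerE (v : ℕ) : NExpr := .add (.mul .dim .dim) (.var v)

/-- The address of a coordinate of the transformed point. -/
def pointE (v : ℕ) : NExpr := .add (scalarE 10) (.var v)

/-- The address of a coordinate of the product of the transformed point and the matrix. -/
def productE (v : ℕ) : NExpr := .add (.add (scalarE 10) .dim) (.var v)

/-- A numeral. -/
def num (k : ℕ) : RExpr := .nat (.lit k)

/-- Difference of the input and the center. -/
def diffE (v : ℕ) : RExpr := .sub (.inp (.var v)) (.mem (centerE v))

/-- The distance of the input and the center. -/
def distCmd : Cmd :=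
  .seq (sumInto 0 (scalarE 5) (.mul (diffE 0) (diffE 0))) (setS 5 (.sqrt (getS 5)))

/-- The transformed point. -/
def pointCmd : Cmd :=
  .loop 0 .dim (sumInto 1 (pointE 0) (.mul (.mem (entryE 0 1)) (diffE 1)))

/-- The norm of the transformed point. -/
def normCmd : Cmd :=
  .seq (sumInto 0 (scalarE 5) (.mul (.mem (pointE 0)) (.mem (pointE 0))))
    (setS 5 (.sqrt (getS 5)))

/-- The product of the transformed point and the matrix. -/
def productCmd : Cmd :=
  .loop 0 .dim (sumInto 1 (productE 0) (.mul (.mem (pointE 1)) (.mem (entryE 1 0))))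

/-- The update parameters. -/
def paramCmd (eγ ea : RExpr) : Cmd :=
  .seq (setS 6 eγ)
  (.seq (setS 7 (.div (num 1) (.add (.div (num 1) (getS 0)) (.mul (num 2) (getS 6)))))
  (.seq (setS 8 ea)
    (setS 9 (.add (num 1) (.div (.sub (getS 0) (getS 7)) (num 2))))))

/-- The new entry of the matrix. -/
def newEntry : RExpr :=
  .add (.mul (.div (num 1) (getS 9)) (.mem (entryE 0 1)))
    (.mul (.sub (.div (num 1) (getS 8)) (.div (num 1) (getS 9)))
      (.mul (.div (.mem (pointE 0)) (getS 5)) (.div (.mem (productE 1)) (getS 5))))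

/-- The new coordinate of the center. -/
def newCenter : RExpr :=
  .add (.mem (centerE 0))
    (.mul (.div (.sub (.mul (getS 7) (getS 8)) (getS 0)) (getS 5)) (diffE 0))

/-- The update of the matrix. -/
def matrixCmd : Cmd := .loop 0 .dim (.loop 1 .dim (.assign (entryE 0 1) newEntry))

/-- The update of the center. -/
def centerCmd : Cmd := .loop 0 .dim (.assign (centerE 0) newCenter)

/-- The full update. -/
def updateCmd (eγ ea : RExpr) : Cmd :=
  .seq pointCmd (.seq normCmd (.ifLe (getS 5) (num 1) .skip
    (.seq productCmd (.seq (paramCmd eγ ea) (.seq matrixCmd (.seq centerCmd (setS 0 (getS 7))))))))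

/-- Replace the rounding by a ball. -/
def ballCmd (ρ α : RExpr) : Cmd :=
  .seq (.loop 0 .dim (.assign (entryE 0 0) (.div (num 1) ρ))) (setS 0 α)

/-- Processing a point. -/
def stepCmd (eγ ea : RExpr) : Cmd :=
  .ifLe (num 1) (getS 4) (updateCmd eγ ea)
    (.seq distCmd (.ifLe (getS 5) (.mul (getS 1) (getS 3))
      (.ifLe (getS 5) (.mul (getS 1) (getS 2)) .skip
        (.seq (ballCmd (getS 5) (.div (getS 1) (getS 5))) (setS 2 (.div (getS 5) (getS 1)))))
      (.seq (ballCmd (.mul (getS 1) (getS 3)) (.div (num 1) (getS 3)))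
        (.seq (setS 4 (num 1)) (updateCmd eγ ea)))))

/-- The initialization. -/
def initCmd : Cmd :=
  .seq (setS 1 (.inp .dim)) (.seq (ballCmd (getS 1) (num 1))
    (.seq (.loop 0 .dim (.assign (centerE 0) (.inp (.var 0))))
      (.seq (setS 2 (num 1))
        (.ifLe (.mul (.nat .dim) (.log (.nat .dim))) (num 2) (setS 3 (num 2))
          (setS 3 (.mul (.nat .dim) (.log (.nat .dim))))))))

/-- The program. -/
def ruleProg (eγ ea : RExpr) : Prog where
  init := initCmd
  step := stepCmd eγ ea

end Program

/-! ### Step counts of the program -/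

theorem dimLoops_initCmd : initCmd.DimLoops := by
  simp [initCmd, ballCmd, setS, Cmd.DimLoops]

theorem dimLoops_stepCmd (eγ ea : RExpr) : (stepCmd eγ ea).DimLoops := by
  simp [stepCmd, updateCmd, pointCmd, normCmd, productCmd, paramCmd, matrixCmd, centerCmd,
    distCmd, ballCmd, setS, sumInto, Cmd.DimLoops]

theorem bound_initCmd_le {d : ℕ} (hd : 1 ≤ d) : initCmd.bound d ≤ 10000 * d ^ 2 := by
  simp only [initCmd, ballCmd, setS, Cmd.bound, RExpr.cost, NExpr.cost, num, getS, scalarE, entryE,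
    centerE]
  nlinarith

/-- Loops are nested at most two deep, so the count is a quadratic polynomial in `d`. It includes
the full update, and with it `eγ` and `ea`, twice: once for each phase. -/
theorem bound_stepCmd_le {d : ℕ} (hd : 1 ≤ d) {eγ ea : RExpr} (h : eγ.cost + ea.cost ≤ 100) :
    (stepCmd eγ ea).bound d ≤ 10000 * d ^ 2 := by
  simp only [stepCmd, updateCmd, pointCmd, normCmd, productCmd, paramCmd, matrixCmd, centerCmd,
    distCmd, ballCmd, setS, sumInto, Cmd.bound, RExpr.cost, NExpr.cost, num, getS, scalarE,
    entryE, centerE, pointE, productE, diffE, newEntry, newCenter]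
  ring_nf
  nlinarith

theorem ruleProg_steps_le {G : ℝ → ℝ → ℝ} {M d : ℕ} (hd : 1 ≤ d) {eγ ea : RExpr}
    (h : eγ.cost + ea.cost ≤ 100) (c₀ : Vec d) (r₀ : ℝ) (z : ℕ → Vec d) (n : ℕ) :
    (ruleProg eγ ea).steps G M c₀ r₀ z n ≤ (n + 1) * (10000 * d ^ 2) := by
  induction n with
  | zero =>
    rw [zero_add, one_mul]
    exact (Cmd.exec_cost_le _ dimLoops_initCmd _ _).trans (bound_initCmd_le hd)
  | succ n ih =>
    rw [add_mul _ 1, one_mul]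
    exact add_le_add ih ((Cmd.exec_cost_le _ (dimLoops_stepCmd eγ ea) _ _).trans
      (bound_stepCmd_le hd h))

/-! ### Correctness of the program -/

section Correctness

variable {G : ℝ → ℝ → ℝ} {d M : ℕ} {inp : ℕ → ℝ} {σ : ℕ → ℕ} {m : Fin M → ℝ}

theorem entry_lt {i j : ℕ} (hi : i < d) (hj : j < d) : i * d + j < d * d := by
  calc i * d + j < i * d + d := by omega
    _ = (i + 1) * d := by ring
    _ ≤ d * d := Nat.mul_le_mul_right d hi

theorem val_scalarE (k : ℕ) : (scalarE k).val d σ = scalar d k := rfl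

theorem val_getS (k : ℕ) : (getS k).val G d inp σ m = readCell m (scalar d k) := rfl

theorem val_num (k : ℕ) : (num k).val G d inp σ m = k := rfl

/-- The bound on `M` is the memory layout: `d²` entries, `d` coordinates of the center, ten scalars,
`d` coordinates of `u`, and `d` of `uᵀ A`. The scalars are `α`, `r₀`, `R`, `T`, the phase, a norm,
`γ`, `α'`, `a`, `b`. -/
theorem readCell_setS (hM : d * d + 3 * d + 10 ≤ M) {k : ℕ} (hk : k < 10) (x : RExpr) (j : ℕ) :
    readCell ((setS k x).exec G d inp σ m).1 j =
      if j = scalar d k then x.val G d inp σ m else readCell m j := by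
  rw [setS, exec_assign, val_scalarE, readCell_writeCell]
  unfold scalar
  omega

theorem readCell_distCmd (hM : d * d + 3 * d + 10 ≤ M) (k : ℕ) :
    readCell (distCmd.exec G d inp σ m).1 k =
      if k = scalar d 5 then
        √(∑ i ∈ Finset.range d, (inp i - readCell m (d * d + i)) * (inp i - readCell m (d * d + i)))
      else readCell m k := by
  have h5 : scalar d 5 < M := by unfold scalar; omega
  rw [distCmd, exec_seq, readCell_setS hM (by norm_num)]
  have hs := exec_sumInto (G := G) (inp := inp) (σ := σ) (m := m) (v := 0) (e := scalarE 5)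
    (x := .mul (diffE 0) (diffE 0))
    (fun i => (inp i - readCell m (d * d + i)) * (inp i - readCell m (d * d + i))) h5
    (val_scalarE 5) (fun i => val_scalarE 5) (by
      intro i hi m' h
      simp only [RExpr.val, diffE, NExpr.val, centerE, Function.update_self]
      rw [h]
      unfold scalar
      omega)
  rw [RExpr.val, val_getS, hs, hs, if_pos rfl]
  split_ifs <;> rfl

theorem readCell_pointCmd (hM : d * d + 3 * d + 10 ≤ M) :
    (∀ i < d, readCell (pointCmd.exec G d inp σ m).1 (scalar d 10 + i) =
      ∑ j ∈ Finset.range d, readCell m (i * d + j) * (inp j - readCell m (d * d + j))) ∧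
    ∀ k, (∀ i < d, k ≠ scalar d 10 + i) →
      readCell (pointCmd.exec G d inp σ m).1 k = readCell m k := by
  apply exec_loop_scatter (addr := fun i => scalar d 10 + i)
  · intro i _ j _ h
    simpa using h
  · intro i hi m' hm' k
    apply exec_sumInto
    · unfold scalar; omega
    · simp [pointE, NExpr.val, scalarE, scalar]
    · simp [pointE, NExpr.val, scalarE, scalar]
    · intro j hj m'' hm''
      have := entry_lt hi hj
      simp only [RExpr.val, diffE, NExpr.val, centerE, entryE, Function.update_self,
        Function.update_of_ne zero_ne_one]
      rw [hm'', hm'', hm', hm']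
      all_goals unfold scalar
      all_goals intros
      all_goals omega

theorem readCell_normCmd (hM : d * d + 3 * d + 10 ≤ M) (k : ℕ) :
    readCell (normCmd.exec G d inp σ m).1 k =
      if k = scalar d 5 then
        √(∑ i ∈ Finset.range d, readCell m (scalar d 10 + i) * readCell m (scalar d 10 + i))
      else readCell m k := by
  have h5 : scalar d 5 < M := by unfold scalar; omega
  rw [normCmd, exec_seq, readCell_setS hM (by norm_num)]
  have hs := exec_sumInto (G := G) (inp := inp) (σ := σ) (m := m) (v := 0) (e := scalarE 5)
    (x := .mul (.mem (pointE 0)) (.mem (pointE 0)))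
    (fun i => readCell m (scalar d 10 + i) * readCell m (scalar d 10 + i)) h5
    (val_scalarE 5) (fun i => val_scalarE 5) (by
      intro i hi m' h
      simp only [RExpr.val, NExpr.val, pointE, val_scalarE, Function.update_self]
      rw [h]
      unfold scalar
      omega)
  rw [RExpr.val, val_getS, hs, hs, if_pos rfl]
  split_ifs <;> rfl

theorem readCell_productCmd (hM : d * d + 3 * d + 10 ≤ M) :
    (∀ j < d, readCell (productCmd.exec G d inp σ m).1 (scalar d 10 + d + j) =
      ∑ i ∈ Finset.range d, readCell m (scalar d 10 + i) * readCell m (i * d + j)) ∧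
    ∀ k, (∀ j < d, k ≠ scalar d 10 + d + j) →
      readCell (productCmd.exec G d inp σ m).1 k = readCell m k := by
  apply exec_loop_scatter (addr := fun j => scalar d 10 + d + j)
  · intro i _ j _ h
    simpa using h
  · intro j hj m' hm' k
    apply exec_sumInto
    · unfold scalar; omega
    · simp [productE, NExpr.val, scalarE, scalar]
    · simp [productE, NExpr.val, scalarE, scalar]
    · intro i hi m'' hm''
      have := entry_lt hi hj
      simp only [RExpr.val, NExpr.val, pointE, val_scalarE, entryE, Function.update_self,
        Function.update_of_ne zero_ne_one]
      rw [hm'', hm'', hm', hm']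
      all_goals unfold scalar
      all_goals intros
      all_goals omega

/-- The update may be done in place: a new entry uses only the old entry in the same cell, scalars,
and the vectors `u` and `uᵀ A` stored beforehand. Row and column of the cell `k` are `k / d` and `k
% d`. -/
theorem readCell_matrixCmd (hM : d * d + 3 * d + 10 ≤ M) :
    ∀ k, readCell (matrixCmd.exec G d inp σ m).1 k =
      if k < d * d then
        1 / readCell m (scalar d 9) * readCell m k +
          (1 / readCell m (scalar d 8) - 1 / readCell m (scalar d 9)) *
          (readCell m (scalar d 10 + k / d) / readCell m (scalar d 5) *
            (readCell m (scalar d 10 + d + k % d) / readCell m (scalar d 5)))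
      else readCell m k := by
  set new : ℕ → ℝ := fun k => 1 / readCell m (scalar d 9) * readCell m k +
    (1 / readCell m (scalar d 8) - 1 / readCell m (scalar d 9)) *
    (readCell m (scalar d 10 + k / d) / readCell m (scalar d 5) *
      (readCell m (scalar d 10 + d + k % d) / readCell m (scalar d 5))) with hnew
  refine exec_loop_induction
    (I := fun i m' => ∀ k, readCell m' k = if k < i * d then new k else readCell m k) ?_ ?_
  · simp
  · intro i hi m' hm'
    rw [add_mul, one_mul]
    refine exec_loop_induction
      (I := fun j m' => ∀ k, readCell m' k = if k < i * d + j then new k else readCell m k) ?_ ?_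
    · simpa using hm'
    · intro j hj m'' hm'' k
      have hij := entry_lt hi hj
      have hdiv : (i * d + j) / d = i := by
        rw [mul_comm, Nat.mul_add_div (by omega), Nat.div_eq_of_lt hj, add_zero]
      have hmod : (i * d + j) % d = j := by
        rw [mul_comm, Nat.mul_add_mod, Nat.mod_eq_of_lt hj]
      have hbig : ∀ n, d * d ≤ n → readCell m'' n = readCell m n := fun n hn => by
        rw [hm'', if_neg (by omega)]
      have hval : newEntry.val G d inp
          (Function.update (Function.update σ 0 i) 1 j) m'' = new (i * d + j) := by
        simp only [newEntry, RExpr.val, val_getS, val_num, NExpr.val, pointE, productE, entryE,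
          val_scalarE, Function.update_self, Function.update_of_ne zero_ne_one, hnew, hdiv, hmod]
        rw [hm'' (i * d + j), if_neg (lt_irrefl _), hbig, hbig, hbig, hbig, hbig]
        · simp
        all_goals unfold scalar
        all_goals omega
      rw [exec_assign, hval]
      simp only [entryE, NExpr.val, Function.update_self, Function.update_of_ne zero_ne_one]
      rw [readCell_writeCell (by omega), hm'']
      split_ifs with h1 h2 h3 h4
      · rw [h1]
      · omega
      · rfl
      · omega
      · omega
      · rfl

theorem readCell_centerCmd (hM : d * d + 3 * d + 10 ≤ M) :
    (∀ i < d, readCell (centerCmd.exec G d inp σ m).1 (d * d + i) =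
      readCell m (d * d + i) +
        (readCell m (scalar d 7) * readCell m (scalar d 8) - readCell m (scalar d 0)) /
          readCell m (scalar d 5) * (inp i - readCell m (d * d + i))) ∧
    ∀ k, (∀ i < d, k ≠ d * d + i) →
      readCell (centerCmd.exec G d inp σ m).1 k = readCell m k := by
  apply exec_loop_scatter (addr := fun i => d * d + i)
  · intro i _ j _ h
    simpa using h
  · intro i hi m' hm' k
    have hc : (centerE 0).val d (Function.update σ 0 i) = d * d + i := by
      simp [centerE, NExpr.val]
    rw [exec_assign, hc, readCell_writeCell (by omega)]
    simp only [newCenter, RExpr.val, val_getS, diffE, hc, NExpr.val, Function.update_self]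
    rw [hm', hm', hm', hm', hm']
    all_goals intros
    all_goals try unfold scalar
    all_goals omega

/-- The radius is evaluated anew in every pass, and the factor after all of them. Hence `ρ` and `α`
must keep their values in any memory that differs only in matrix and center. -/
theorem readCell_ballCmd (hM : d * d + 3 * d + 10 ≤ M) {ρ α : RExpr} {r a : ℝ}
    (hρ : ∀ (σ : ℕ → ℕ) (m' : Fin M → ℝ), (∀ k, d * d + d ≤ k → readCell m' k = readCell m k) →
      ρ.val G d inp σ m' = r)
    (hα : ∀ (σ : ℕ → ℕ) (m' : Fin M → ℝ), (∀ k, d * d + d ≤ k → readCell m' k = readCell m k) →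
      α.val G d inp σ m' = a) :
    (∀ i < d, readCell ((ballCmd ρ α).exec G d inp σ m).1 (i * d + i) = 1 / r) ∧
    readCell ((ballCmd ρ α).exec G d inp σ m).1 (scalar d 0) = a ∧
    ∀ k, (∀ i < d, k ≠ i * d + i) → k ≠ scalar d 0 →
      readCell ((ballCmd ρ α).exec G d inp σ m).1 k = readCell m k := by
  obtain ⟨h1, h2⟩ := exec_loop_scatter (G := G) (d := d) (M := M) (inp := inp) (σ := σ) (m := m) (v := 0)
    (p := .assign (entryE 0 0) (.div (num 1) ρ)) (fun i => i * d + i) (fun _ => 1 / r)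
    (by
      intro i _ j _ h
      have : i * (d + 1) = j * (d + 1) := by linarith
      exact Nat.eq_of_mul_eq_mul_right (by omega) this)
    (by
      intro i hi m' hm' k
      have := entry_lt hi hi
      rw [exec_assign, RExpr.val, hρ]
      · simp only [entryE, NExpr.val, Function.update_self, val_num]
        rw [readCell_writeCell (by omega)]
        simp
      · intro k hk
        apply hm'
        intro j hj
        have := entry_lt (hj.trans hi) (hj.trans hi)
        omega)
  simp only [ballCmd, exec_seq, readCell_setS hM (show 0 < 10 by norm_num)]
  refine ⟨?_, ?_, ?_⟩
  · intro i hi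
    have := entry_lt hi hi
    rw [if_neg (by unfold scalar; omega), h1 i hi]
  · rw [if_pos trivial, hα]
    intro k hk
    apply h2
    intro j hj
    have := entry_lt hj hj
    omega
  · intro k hk hk0
    rw [if_neg hk0, h2 k hk]

theorem vecInput_apply {x : Vec d} (i : Fin d) : vecInput x i = x i := by
  simp [vecInput]

theorem sqrt_sum_eq_norm (x : Vec d) (f : ℕ → ℝ) (hf : ∀ i : Fin d, f i = x i) :
    √(∑ i ∈ Finset.range d, f i * f i) = ‖x‖ := by
  rw [EuclideanSpace.norm_eq, Finset.sum_range]
  congr 1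
  apply Finset.sum_congr rfl
  intro i _
  rw [hf, Real.norm_eq_abs, sq_abs, sq]

/-- The memory holds the rounding `s`. -/
structure Holds (m : Fin M → ℝ) (s : Rounding d) : Prop where
  entry : ∀ i j : Fin d, readCell m (i * d + j) = s.A i j
  center : ∀ i : Fin d, readCell m (d * d + i) = s.c i
  alpha : readCell m (scalar d 0) = s.α

theorem Holds.readRounding_eq {s : Rounding d} (h : Holds m s) : readRounding d m = s := by
  ext i j
  · exact h.entry i j
  · exact h.center i
  · exact h.alpha

theorem Holds.congr {s : Rounding d} {m' : Fin M → ℝ} (h : Holds m s)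
    (hm : ∀ k ≤ scalar d 0, readCell m' k = readCell m k) : Holds m' s where
  entry := fun i j => by
    have := entry_lt i.2 j.2
    rw [hm _ (by unfold scalar; omega), h.entry]
  center := fun i => by rw [hm _ (by unfold scalar; omega), h.center]
  alpha := by rw [hm _ le_rfl, h.alpha]

/-- The expressions `eγ` and `ea` compute the growth parameter and the long semiaxis. -/
structure Computes (G : ℝ → ℝ → ℝ) (U : UpdateRule) (eγ ea : RExpr) : Prop where
  growth : ∀ {d M : ℕ} (inp : ℕ → ℝ) (σ : ℕ → ℕ) (m : Fin M → ℝ),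
    eγ.val G d inp σ m = U.growth (readCell m (scalar d 0)) (readCell m (scalar d 5))
  axis : ∀ {d M : ℕ} (inp : ℕ → ℝ) (σ : ℕ → ℕ) (m : Fin M → ℝ),
    readCell m (scalar d 6) = U.growth (readCell m (scalar d 0)) (readCell m (scalar d 5)) →
    readCell m (scalar d 7) = alphaPar (readCell m (scalar d 0)) (readCell m (scalar d 6)) →
    ea.val G d inp σ m = U.axis (readCell m (scalar d 0)) (readCell m (scalar d 5))
  cost_le : eγ.cost + ea.cost ≤ 100

variable {U : UpdateRule} {eγ ea : RExpr}

theorem readCell_paramCmd (hM : d * d + 3 * d + 10 ≤ M) (hU : Computes G U eγ ea) {α x γ a : ℝ}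
    (hα : readCell m (scalar d 0) = α) (hx : readCell m (scalar d 5) = x)
    (hγ : U.growth α x = γ) (ha : U.axis α x = a) :
    readCell ((paramCmd eγ ea).exec G d inp σ m).1 (scalar d 7) = alphaPar α γ ∧
    readCell ((paramCmd eγ ea).exec G d inp σ m).1 (scalar d 8) = a ∧
    readCell ((paramCmd eγ ea).exec G d inp σ m).1 (scalar d 9) = bPar α γ ∧
    ∀ k, (k < scalar d 6 ∨ scalar d 9 < k) →
      readCell ((paramCmd eγ ea).exec G d inp σ m).1 k = readCell m k := by
  have hne : ∀ i j, i ≠ j → scalar d i ≠ scalar d j := by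
    intro i j h
    unfold scalar
    omega
  unfold paramCmd
  rw [exec_seq, exec_seq, exec_seq]
  have h1 : ∀ k, readCell ((setS 6 eγ).exec G d inp σ m).1 k =
      if k = scalar d 6 then γ else readCell m k := by
    intro k
    rw [readCell_setS hM (by norm_num), hU.growth, hα, hx, hγ]
  generalize ((setS 6 eγ).exec G d inp σ m).1 = m1 at h1 ⊢
  set e7 : RExpr := .div (num 1) (.add (.div (num 1) (getS 0)) (.mul (num 2) (getS 6)))
  have h2 : ∀ k, readCell ((setS 7 e7).exec G d inp σ m1).1 k =
      if k = scalar d 7 then alphaPar α γ else readCell m1 k := by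
    intro k
    rw [readCell_setS hM (by norm_num)]
    simp only [e7, RExpr.val, val_getS, val_num, h1, hne 0 6 (by norm_num), if_false, if_true, hα,
      alphaPar, Nat.cast_one, Nat.cast_ofNat]
  generalize ((setS 7 e7).exec G d inp σ m1).1 = m2 at h2 ⊢
  have h3 : ∀ k, readCell ((setS 8 ea).exec G d inp σ m2).1 k =
      if k = scalar d 8 then a else readCell m2 k := by
    intro k
    have h0 : readCell m2 (scalar d 0) = α := by
      rw [h2, if_neg (hne 0 7 (by norm_num)), h1, if_neg (hne 0 6 (by norm_num)), hα]
    have h5 : readCell m2 (scalar d 5) = x := by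
      rw [h2, if_neg (hne 5 7 (by norm_num)), h1, if_neg (hne 5 6 (by norm_num)), hx]
    have h6 : readCell m2 (scalar d 6) = γ := by
      rw [h2, if_neg (hne 6 7 (by norm_num)), h1, if_pos rfl]
    rw [readCell_setS hM (by norm_num), hU.axis, h0, h5, ha]
    · rw [h0, h5, h6, hγ]
    · rw [h0, h6, h2, if_pos rfl]
  generalize ((setS 8 ea).exec G d inp σ m2).1 = m3 at h3 ⊢
  set e9 : RExpr := .add (num 1) (.div (.sub (getS 0) (getS 7)) (num 2))
  have h4 : ∀ k, readCell ((setS 9 e9).exec G d inp σ m3).1 k =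
      if k = scalar d 9 then bPar α γ else readCell m3 k := by
    intro k
    rw [readCell_setS hM (by norm_num)]
    simp only [e9, RExpr.val, val_getS, val_num, h3, h2, h1, hne 0 6 (by norm_num),
      hne 0 7 (by norm_num), hne 0 8 (by norm_num), hne 7 8 (by norm_num), if_false, if_true, hα,
      bPar, Nat.cast_one, Nat.cast_ofNat]
  generalize ((setS 9 e9).exec G d inp σ m3).1 = m4 at h4 ⊢
  refine ⟨?_, ?_, ?_, ?_⟩
  · rw [h4, if_neg (hne 7 9 (by norm_num)), h3, if_neg (hne 7 8 (by norm_num)), h2, if_pos rfl]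
  · rw [h4, if_neg (hne 8 9 (by norm_num)), h3, if_pos rfl]
  · rw [h4, if_pos rfl]
  · intro k hk
    unfold scalar at *
    rw [h4, if_neg (by omega), h3, if_neg (by omega), h2, if_neg (by omega), h1,
      if_neg (by omega)]

theorem UpdateRule.update_entry {s : Rounding d} {z : Vec d} {u : Vec d}
    (hu : mv s.A (z - s.c) = u) (h : 1 < ‖u‖) (i j : Fin d) :
    (U.update s z).A i j = 1 / bPar s.α (U.growth s.α ‖u‖) * s.A i j +
      (1 / U.axis s.α ‖u‖ - 1 / bPar s.α (U.growth s.α ‖u‖)) *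
        (u i / ‖u‖ * ((∑ k, u k * s.A k j) / ‖u‖)) := by
  subst hu
  simp only [UpdateRule.update, h, if_true, Matrix.add_mul, Matrix.smul_mul, Matrix.one_mul,
    Matrix.add_apply, Matrix.smul_apply, smul_eq_mul, Matrix.mul_apply, Matrix.vecMulVec_apply,
    PiLp.smul_apply]
  congr 2
  rw [Finset.sum_div, Finset.mul_sum]
  apply Finset.sum_congr rfl
  intro k _
  ring

/-- Since `A⁻¹ u = z - c`, the shift is a multiple of `z - c`, and the program needs no inverse
matrix. -/
theorem UpdateRule.update_center {s : Rounding d} {z : Vec d} {u : Vec d}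
    (hA : IsUnit s.A.det) (hu : mv s.A (z - s.c) = u) (h : 1 < ‖u‖) (i : Fin d) :
    (U.update s z).c i = s.c i + (alphaPar s.α (U.growth s.α ‖u‖) * U.axis s.α ‖u‖ - s.α) / ‖u‖ *
      (z i - s.c i) := by
  subst hu
  simp only [UpdateRule.update, h, if_true, mv_smul, mv_inv_mv hA, PiLp.add_apply,
    PiLp.smul_apply, PiLp.sub_apply, smul_eq_mul]
  ring

theorem exec_updateCmd (hM : d * d + 3 * d + 10 ≤ M) (hU : Computes G U eγ ea) {s : Rounding d}
    (hA : IsUnit s.A.det) (hs : Holds m s) (z : Vec d) :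
    Holds ((updateCmd eγ ea).exec G d (vecInput z) σ m).1 (U.update s z) ∧
      ∀ k, 1 ≤ k → k ≤ 4 →
        readCell ((updateCmd eγ ea).exec G d (vecInput z) σ m).1 (scalar d k) =
          readCell m (scalar d k) := by
  set u := mv s.A (z - s.c) with hu
  rw [updateCmd, exec_seq, exec_seq]
  obtain ⟨p1, p2⟩ := readCell_pointCmd (G := G) (inp := vecInput z) (σ := σ) (m := m) hM
  generalize (pointCmd.exec G d (vecInput z) σ m).1 = m1 at p1 p2 ⊢
  have hp2 : ∀ k < scalar d 10, readCell m1 k = readCell m k := fun k hk =>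
    p2 k fun i _ => by omega
  have hp1 : ∀ i : Fin d, readCell m1 (scalar d 10 + i) = u i := by
    intro i
    rw [p1 i i.2, Finset.sum_range]
    simp only [hs.entry, hs.center, vecInput_apply]
    simp [hu, mv, Matrix.mulVec, dotProduct]
  clear p1 p2
  have q := readCell_normCmd (G := G) (inp := vecInput z) (σ := σ) (m := m1) hM
  rw [sqrt_sum_eq_norm u (fun i => readCell m1 (scalar d 10 + i)) hp1] at q
  generalize (normCmd.exec G d (vecInput z) σ m1).1 = m2 at q ⊢
  have hq5 : readCell m2 (scalar d 5) = ‖u‖ := by rw [q, if_pos rfl]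
  have hqu : ∀ i : Fin d, readCell m2 (scalar d 10 + i) = u i := by
    intro i
    rw [q, if_neg (by unfold scalar; omega), hp1]
  have hq2 : ∀ k < scalar d 5, readCell m2 k = readCell m k := by
    intro k hk
    rw [q, if_neg hk.ne, hp2]
    unfold scalar at *
    omega
  have hs2 : Holds m2 s := hs.congr fun k hk => hq2 k (by unfold scalar at *; omega)
  clear q hp1 hp2
  rw [exec_ifLe, val_getS, val_num, hq5, Nat.cast_one]
  by_cases h : ‖u‖ ≤ 1
  · rw [if_pos h, UpdateRule.update_of_norm_le h]
    exact ⟨hs2, fun k _ hk => hq2 _ (by unfold scalar; omega)⟩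
  · rw [if_neg h]
    rw [not_le] at h
    rw [exec_seq, exec_seq, exec_seq, exec_seq]
    obtain ⟨r1, r2⟩ := readCell_productCmd (G := G) (inp := vecInput z) (σ := σ) (m := m2) hM
    generalize (productCmd.exec G d (vecInput z) σ m2).1 = m3 at r1 r2 ⊢
    have hr2 : ∀ k < scalar d 10 + d, readCell m3 k = readCell m2 k := fun k hk =>
      r2 k fun i _ => by omega
    have hr1 : ∀ j : Fin d, readCell m3 (scalar d 10 + d + j) = ∑ k, u k * s.A k j := by
      intro j
      rw [r1 j j.2, Finset.sum_range]
      simp only [hqu, hs2.entry]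
    clear r1 r2
    have hα3 : readCell m3 (scalar d 0) = s.α := by
      rw [hr2 _ (by unfold scalar; omega), hs2.alpha]
    have hx3 : readCell m3 (scalar d 5) = ‖u‖ := by
      rw [hr2 _ (by unfold scalar; omega), hq5]
    obtain ⟨t7, t8, t9, t⟩ := readCell_paramCmd (inp := vecInput z) (σ := σ) hM hU hα3 hx3 rfl rfl
    generalize ((paramCmd eγ ea).exec G d (vecInput z) σ m3).1 = m4 at t7 t8 t9 t ⊢
    have w := readCell_matrixCmd (G := G) (inp := vecInput z) (σ := σ) (m := m4) hM
    generalize (matrixCmd.exec G d (vecInput z) σ m4).1 = m5 at w ⊢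
    have hw : ∀ k, d * d ≤ k → readCell m5 k = readCell m4 k := fun k hk => by
      rw [w, if_neg (by omega)]
    obtain ⟨v1, v2⟩ := readCell_centerCmd (G := G) (inp := vecInput z) (σ := σ) (m := m5) hM
    generalize (centerCmd.exec G d (vecInput z) σ m5).1 = m6 at v1 v2 ⊢
    -- The cell of `α` is overwritten last, because the update of the center still reads the old
    -- value.
    have hend := fun k => readCell_setS (G := G) (inp := vecInput z) (σ := σ) (m := m6) hM
      (show 0 < 10 by norm_num) (getS 7) k
    have h45 : ∀ k, d * d + d ≤ k → readCell m6 k = readCell m4 k := by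
      intro k hk
      rw [v2 k (fun i hi => by omega), hw k (by omega)]
    rw [val_getS, h45 _ (by unfold scalar; omega), t7] at hend
    refine ⟨⟨?_, ?_, ?_⟩, ?_⟩
    · intro i j
      have hij := entry_lt i.2 j.2
      have hdiv : (i * d + j) / d = (i : ℕ) := by
        rw [mul_comm, Nat.mul_add_div (by omega), Nat.div_eq_of_lt j.2, add_zero]
      have hmod : (i * d + j) % d = (j : ℕ) := by
        rw [mul_comm, Nat.mul_add_mod, Nat.mod_eq_of_lt j.2]
      rw [hend, if_neg (by unfold scalar; omega), v2 _ (fun i _ => by omega), w, if_pos hij, hdiv,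
        hmod, t8, t9, t _ (by unfold scalar; omega), t _ (by unfold scalar; omega),
        t _ (by unfold scalar; omega), t _ (by unfold scalar; omega), hr1, hx3,
        hr2 _ (by unfold scalar; omega), hr2 _ (by unfold scalar; omega), hqu, hs2.entry,
        UpdateRule.update_entry hu.symm h]
    · intro i
      rw [hend, if_neg (by unfold scalar; omega), v1 i i.2, hw _ (by omega),
        hw _ (by unfold scalar; omega), hw _ (by unfold scalar; omega),
        hw _ (by unfold scalar; omega), hw _ (by unfold scalar; omega), t7, t8,
        t _ (by unfold scalar; omega), t _ (by unfold scalar; omega),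
        t _ (by unfold scalar; omega), hα3, hx3, hr2 _ (by unfold scalar; omega), hs2.center,
        vecInput_apply, UpdateRule.update_center hA hu.symm h]
    · rw [hend, if_pos rfl, UpdateRule.update_alpha h]
    · intro k hk1 hk4
      rw [hend, if_neg (by unfold scalar; omega), h45 _ (by unfold scalar; omega),
        t _ (by unfold scalar; omega), hr2 _ (by unfold scalar; omega),
        hq2 _ (by unfold scalar; omega)]

/-- The memory represents the state `s` of the algorithm. -/
structure Represents (m : Fin M → ℝ) (r₀ : ℝ) (s : AlgState d) : Prop where
  holds : Holds m s.out
  radius : readCell m (scalar d 1) = r₀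
  ratio : readCell m (scalar d 2) = s.R
  threshold : readCell m (scalar d 3) = threshold d
  phase : readCell m (scalar d 4) = if s.phaseII = true then 1 else 0

/-- Only the diagonal is written. That suffices because the memory already holds a multiple of the
identity, as it does throughout the first phase. -/
theorem holds_ballCmd (hM : d * d + 3 * d + 10 ≤ M) {ρ α : RExpr} {r r' a a' : ℝ} {c : Vec d}
    (hm : Holds m (ballRounding c r' a'))
    (hρ : ∀ (σ : ℕ → ℕ) (m' : Fin M → ℝ), (∀ k, d * d + d ≤ k → readCell m' k = readCell m k) →
      ρ.val G d inp σ m' = r)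
    (hα : ∀ (σ : ℕ → ℕ) (m' : Fin M → ℝ), (∀ k, d * d + d ≤ k → readCell m' k = readCell m k) →
      α.val G d inp σ m' = a) :
    Holds ((ballCmd ρ α).exec G d inp σ m).1 (ballRounding c r a) ∧
      ∀ k, scalar d 0 < k →
        readCell ((ballCmd ρ α).exec G d inp σ m).1 k = readCell m k := by
  obtain ⟨h1, h2, h3⟩ := readCell_ballCmd (σ := σ) hM hρ hα
  refine ⟨⟨?_, ?_, h2⟩, ?_⟩
  · intro i j
    have hij := entry_lt i.2 j.2
    by_cases h : i = j
    · subst h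
      rw [h1 i i.2]
      simp [ballRounding]
    · have hne : (i : ℕ) ≠ j := fun e => h (Fin.ext e)
      rw [h3 _ _ (by unfold scalar; omega), hm.entry]
      · simp [ballRounding, h]
      · intro k hk e
        have e1 : (i * d + j) / d = (i : ℕ) := by
          rw [mul_comm, Nat.mul_add_div (by omega), Nat.div_eq_of_lt j.2, add_zero]
        have e2 : (k * d + k) / d = k := by
          rw [mul_comm, Nat.mul_add_div (by omega), Nat.div_eq_of_lt hk, add_zero]
        have : (i : ℕ) = k := by rw [← e1, e, e2]
        subst this
        omega
  · intro i
    rw [h3 _ _ (by unfold scalar; omega), hm.center]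
    · rfl
    · intro k hk
      have := entry_lt hk hk
      omega
  · intro k hk
    apply h3 _ _ hk.ne'
    intro j hj
    have := entry_lt hj hj
    unfold scalar at hk
    omega

/-- The invariant supplies what the program takes for granted: `A` is non-singular when the center
is moved, and in the first phase the matrix is scalar and the center is still `c₀`. -/
theorem represents_step (hM : d * d + 3 * d + 10 ≤ M) (hU : Computes G U eγ ea) {c₀ : Vec d}
    {r₀ : ℝ} (hr : 0 < r₀) {z : ℕ → Vec d} {t : ℕ} {s : AlgState d}
    (hinv : UpdateRule.Invariant c₀ r₀ z t s) (h : Represents m r₀ s) :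
    Represents ((stepCmd eγ ea).exec G d (vecInput (z t)) σ m).1 r₀ (U.step c₀ r₀ s (z t)) := by
  rw [stepCmd, exec_ifLe, val_num, val_getS, h.phase, Nat.cast_one]
  by_cases hph : s.phaseII = true
  · rw [if_pos hph, if_pos le_rfl]
    obtain ⟨g1, g2⟩ := exec_updateCmd (σ := σ) hM hU (hinv.isUnit hr) h.holds (z t)
    rw [UpdateRule.step, if_pos hph]
    refine ⟨g1, ?_, ?_, ?_, ?_⟩
    · rw [g2 _ (by norm_num) (by norm_num), h.radius]
    · rw [g2 _ (by norm_num) (by norm_num), h.ratio]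
    · rw [g2 _ (by norm_num) (by norm_num), h.threshold]
    · rw [g2 _ (by norm_num) (by norm_num), h.phase]
  · obtain ⟨-, hout, h1, -⟩ := hinv.resolve_right fun hc => hph hc.1
    rw [if_neg hph, if_neg (by norm_num), exec_seq]
    have hh := h.holds
    rw [hout] at hh
    have q := readCell_distCmd (G := G) (inp := vecInput (z t)) (σ := σ) (m := m) hM
    rw [sqrt_sum_eq_norm (z t - c₀)
      (fun i => vecInput (z t) i - readCell m (d * d + i)) (by
        intro i
        rw [vecInput_apply, hh.center]
        rfl)] at q
    generalize (distCmd.exec G d (vecInput (z t)) σ m).1 = m1 at q ⊢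
    have hm1 : ∀ k < scalar d 5, readCell m1 k = readCell m k := fun k hk => by
      rw [q, if_neg hk.ne]
    have q5 : readCell m1 (scalar d 5) = ‖z t - c₀‖ := by rw [q, if_pos rfl]
    have q1 : readCell m1 (scalar d 1) = r₀ := by rw [hm1 _ (by unfold scalar; omega), h.radius]
    have q2 : readCell m1 (scalar d 2) = s.R := by rw [hm1 _ (by unfold scalar; omega), h.ratio]
    have q3 : readCell m1 (scalar d 3) = StreamingEllipsoid.threshold d := by
      rw [hm1 _ (by unfold scalar; omega), h.threshold]
    have q4 : readCell m1 (scalar d 4) = 0 := by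
      rw [hm1 _ (by unfold scalar; omega), h.phase, if_neg hph]
    have hh1 := h.holds.congr fun k hk => hm1 k (by unfold scalar at *; omega)
    have hb1 := hh.congr fun k hk => hm1 k (by unfold scalar at *; omega)
    rw [exec_ifLe, RExpr.val, val_getS, val_getS, val_getS, q5, q1, q3]
    rw [UpdateRule.step, if_neg hph]
    by_cases hz : ‖z t - c₀‖ ≤ r₀ * StreamingEllipsoid.threshold d
    · rw [if_pos hz, if_pos hz, exec_ifLe, RExpr.val, val_getS, val_getS, val_getS, q5, q1, q2]
      by_cases hR : ‖z t - c₀‖ ≤ r₀ * s.R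
      · rw [if_pos hR, if_neg (not_lt.2 hR)]
        refine ⟨hh1, q1, q2, q3, ?_⟩
        rw [if_neg hph]
        exact q4
      · rw [if_neg hR, if_pos (not_le.1 hR), exec_seq]
        obtain ⟨b1, b2⟩ := holds_ballCmd (G := G) (inp := vecInput (z t)) (σ := σ)
          (ρ := getS 5) (α := .div (getS 1) (getS 5)) (r := ‖z t - c₀‖) (a := r₀ / ‖z t - c₀‖)
          hM hb1 (by
            intro σ m' hm'
            rw [val_getS, hm' _ (by unfold scalar; omega), q5]) (by
            intro σ m' hm'
            rw [RExpr.val, val_getS, val_getS, hm' _ (by unfold scalar; omega),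
              hm' _ (by unfold scalar; omega), q1, q5])
        generalize ((ballCmd (getS 5) (.div (getS 1) (getS 5))).exec G d
          (vecInput (z t)) σ m1).1 = m2 at b1 b2 ⊢
        have hend := fun k => readCell_setS (G := G) (inp := vecInput (z t)) (σ := σ) (m := m2) hM
          (show 2 < 10 by norm_num) (.div (getS 5) (getS 1)) k
        rw [RExpr.val, val_getS, val_getS, b2 _ (by unfold scalar; omega),
          b2 _ (by unfold scalar; omega), q5, q1] at hend
        refine ⟨b1.congr fun k hk => ?_, ?_, ?_, ?_, ?_⟩
        · rw [hend, if_neg (by unfold scalar at *; omega)]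
        · rw [hend, if_neg (by unfold scalar; omega), b2 _ (by unfold scalar; omega), q1]
        · rw [hend, if_pos rfl]
        · rw [hend, if_neg (by unfold scalar; omega), b2 _ (by unfold scalar; omega), q3]
        · rw [hend, if_neg (by unfold scalar; omega), b2 _ (by unfold scalar; omega), q4]
          simp
    · rw [if_neg hz, if_neg hz, exec_seq, exec_seq]
      obtain ⟨b1, b2⟩ := holds_ballCmd (G := G) (inp := vecInput (z t)) (σ := σ)
        (ρ := .mul (getS 1) (getS 3)) (α := .div (num 1) (getS 3))
        (r := r₀ * StreamingEllipsoid.threshold d) (a := 1 / StreamingEllipsoid.threshold d)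
        hM hb1 (by
          intro σ m' hm'
          rw [RExpr.val, val_getS, val_getS, hm' _ (by unfold scalar; omega),
            hm' _ (by unfold scalar; omega), q1, q3]) (by
          intro σ m' hm'
          rw [RExpr.val, val_getS, val_num, hm' _ (by unfold scalar; omega), q3, Nat.cast_one])
      generalize ((ballCmd (.mul (getS 1) (getS 3)) (.div (num 1) (getS 3))).exec G d
        (vecInput (z t)) σ m1).1 = m2 at b1 b2 ⊢
      have he := fun k => readCell_setS (G := G) (inp := vecInput (z t)) (σ := σ) (m := m2) hM
        (show 4 < 10 by norm_num) (num 1) k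
      generalize ((setS 4 (num 1)).exec G d (vecInput (z t)) σ m2).1 = m3 at he ⊢
      have hT := two_le_threshold d
      obtain ⟨g1, g2⟩ := exec_updateCmd (m := m3) (σ := σ) hM hU
        (isUnit_ballRounding_det (c := c₀) (α := 1 / StreamingEllipsoid.threshold d)
          (show 0 < r₀ * StreamingEllipsoid.threshold d by positivity))
        (b1.congr fun k hk => by rw [he, if_neg (by unfold scalar at *; omega)]) (z t)
      refine ⟨g1, ?_, ?_, ?_, ?_⟩
      · rw [g2 _ (by norm_num) (by norm_num), he, if_neg (by unfold scalar; omega),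
          b2 _ (by unfold scalar; omega), q1]
      · rw [g2 _ (by norm_num) (by norm_num), he, if_neg (by unfold scalar; omega),
          b2 _ (by unfold scalar; omega), q2]
      · rw [g2 _ (by norm_num) (by norm_num), he, if_neg (by unfold scalar; omega),
          b2 _ (by unfold scalar; omega), q3]
      · rw [g2 _ (by norm_num) (by norm_num), he, if_pos rfl, val_num, if_pos rfl, Nat.cast_one]

theorem represents_init (hM : d * d + 3 * d + 10 ≤ M) (c₀ : Vec d) (r₀ : ℝ) :
    Represents (initCmd.exec G d (initInput c₀ r₀) σ (fun _ : Fin M => 0)).1 r₀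
      (algInit c₀ r₀) := by
  have h0 : ∀ k, readCell (fun _ : Fin M => (0 : ℝ)) k = 0 := by
    intro k
    simp [readCell]
  rw [initCmd, exec_seq, exec_seq, exec_seq, exec_seq]
  have e1 := fun k => readCell_setS (G := G) (inp := initInput c₀ r₀) (σ := σ)
    (m := fun _ : Fin M => (0 : ℝ)) hM (show 1 < 10 by norm_num) (.inp .dim) k
  have hin : (RExpr.inp .dim).val G d (initInput c₀ r₀) σ (fun _ : Fin M => (0 : ℝ)) = r₀ := by
    simp [RExpr.val, NExpr.val, initInput]
  simp only [hin, h0] at e1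
  generalize ((setS 1 (.inp .dim)).exec G d (initInput c₀ r₀) σ fun _ : Fin M => (0 : ℝ)).1 = m1
    at e1 ⊢
  -- The blank memory counts as the ball of radius `0` around `0`: as `1 / 0 = 0`, its matrix is the
  -- zero matrix.
  obtain ⟨b1, b2⟩ := holds_ballCmd (G := G) (inp := initInput c₀ r₀) (σ := σ) (m := m1)
    (ρ := getS 1) (α := num 1) (r := r₀) (a := 1) (r' := 0) (a' := 0) (c := 0)
    hM ⟨by
      intro i j
      have := entry_lt i.2 j.2
      rw [e1, if_neg (by unfold scalar; omega)]
      simp [ballRounding], by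
      intro i
      rw [e1, if_neg (by unfold scalar; omega)]
      simp [ballRounding], by
      rw [e1, if_neg (by unfold scalar; omega)]
      rfl⟩ (by
      intro σ m' hm'
      rw [val_getS, hm' _ (by unfold scalar; omega), e1, if_pos rfl]) (by
      intro σ m' _
      rw [val_num, Nat.cast_one])
  generalize ((ballCmd (getS 1) (num 1)).exec G d (initInput c₀ r₀) σ m1).1 = m2 at b1 b2 ⊢
  obtain ⟨c1, c2⟩ := exec_loop_scatter (G := G) (d := d) (inp := initInput c₀ r₀) (σ := σ)
    (m := m2) (v := 0) (p := .assign (centerE 0) (.inp (.var 0))) (fun i => d * d + i)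
    (initInput c₀ r₀) (by intro i _ j _ h; simpa using h) (by
      intro i hi m' _ k
      have hc : (centerE 0).val d (Function.update σ 0 i) = d * d + i := by
        simp [centerE, NExpr.val]
      rw [exec_assign, hc, readCell_writeCell (by omega)]
      simp [RExpr.val, NExpr.val])
  generalize ((Cmd.loop 0 .dim (.assign (centerE 0) (.inp (.var 0)))).exec G d
    (initInput c₀ r₀) σ m2).1 = m3 at c1 c2 ⊢
  have f2 := fun k => readCell_setS (G := G) (inp := initInput c₀ r₀) (σ := σ)
    (m := m3) hM (show 2 < 10 by norm_num) (num 1) k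
  rw [val_num, Nat.cast_one] at f2
  generalize ((setS 2 (num 1)).exec G d (initInput c₀ r₀) σ m3).1 = m4 at f2 ⊢
  have f3 : ∀ k, readCell ((Cmd.ifLe (.mul (.nat .dim) (.log (.nat .dim))) (num 2)
      (setS 3 (num 2)) (setS 3 (.mul (.nat .dim) (.log (.nat .dim))))).exec G d
      (initInput c₀ r₀) σ m4).1 k = if k = scalar d 3 then threshold d else readCell m4 k := by
    intro k
    rw [exec_ifLe, threshold]
    by_cases h : (d : ℝ) * Real.log d ≤ 2
    · rw [if_pos (by simpa [RExpr.val, NExpr.val, num] using h), readCell_setS hM (by norm_num),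
        max_eq_left h]
      simp [val_num]
    · rw [if_neg (by simpa [RExpr.val, NExpr.val, num] using h), readCell_setS hM (by norm_num),
        max_eq_right (not_le.1 h).le]
      simp [RExpr.val, NExpr.val]
  generalize ((Cmd.ifLe (.mul (.nat .dim) (.log (.nat .dim))) (num 2)
      (setS 3 (num 2)) (setS 3 (.mul (.nat .dim) (.log (.nat .dim))))).exec G d
      (initInput c₀ r₀) σ m4).1 = m5 at f3 ⊢
  have hlow : ∀ k ≤ scalar d 0, readCell m5 k = readCell m3 k := by
    intro k hk
    unfold scalar at *
    rw [f3, if_neg (by omega), f2, if_neg (by omega)]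
  refine ⟨⟨?_, ?_, ?_⟩, ?_, ?_, ?_, ?_⟩
  · intro i j
    have := entry_lt i.2 j.2
    rw [hlow _ (by unfold scalar; omega), c2 _ (fun k _ => by omega), b1.entry]
    rfl
  · intro i
    rw [hlow _ (by unfold scalar; omega), c1 i i.2]
    simp [initInput, algInit, ballRounding]
  · rw [hlow _ le_rfl, c2 _ (fun k _ => by unfold scalar; omega), b1.alpha]
    rfl
  · rw [f3, if_neg (by unfold scalar; omega), f2, if_neg (by unfold scalar; omega),
      c2 _ (fun k _ => by unfold scalar; omega), b2 _ (by unfold scalar; omega), e1, if_pos rfl]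
  · rw [f3, if_neg (by unfold scalar; omega), f2, if_pos rfl]
    rfl
  · rw [f3, if_pos rfl]
  · rw [f3, if_neg (by unfold scalar; omega), f2, if_neg (by unfold scalar; omega),
      c2 _ (fun k _ => by unfold scalar; omega), b2 _ (by unfold scalar; omega), e1,
      if_neg (by unfold scalar; omega)]
    simp [algInit]

theorem represents_run (hM : d * d + 3 * d + 10 ≤ M) (hU : Computes G U eγ ea) (hv : U.IsValid)
    (hd : 1 ≤ d) (c₀ : Vec d) {r₀ : ℝ} (hr : 0 < r₀) (z : ℕ → Vec d) (t : ℕ) :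
    Represents ((ruleProg eγ ea).run G M c₀ r₀ z t).1 r₀ (U.state c₀ r₀ z t) := by
  induction t with
  | zero => exact represents_init hM c₀ r₀
  | succ t ih => exact represents_step hM hU hr (UpdateRule.invariant_state hv hd hr t) ih

theorem ruleProg_out (hM : d * d + 3 * d + 10 ≤ M) (hU : Computes G U eγ ea) (hv : U.IsValid)
    (hd : 1 ≤ d) (c₀ : Vec d) {r₀ : ℝ} (hr : 0 < r₀) (z : ℕ → Vec d) (t : ℕ) :
    (ruleProg eγ ea).out G M c₀ r₀ z t = (U.state c₀ r₀ z t).out :=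
  (represents_run hM hU hv hd c₀ hr z t).holds.readRounding_eq

end Correctness

/-! ### The two programs -/

/-- The growth parameter from the subroutine. -/
def rootGrowth : RExpr := .call (getS 0) (getS 5)

/-- The long semiaxis for the growth parameter from the subroutine. -/
def rootAxis : RExpr := .exp (getS 6)

/-- The growth parameter in closed form. -/
def logGrowth : RExpr := .log (.div (.add (getS 5) (getS 0)) (.add (num 1) (getS 0)))

/-- The long semiaxis for the growth parameter in closed form. -/
def logAxis : RExpr := .div (.add (getS 5) (getS 0)) (.add (num 1) (getS 7))

theorem computes_rootRule : Computes gammaStar rootRule rootGrowth rootAxis where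
  growth := fun _ _ _ => rfl
  axis := by
    intro d M inp σ m h _
    rw [rootAxis, RExpr.val, val_getS, h]
    rfl
  cost_le := by simp [rootGrowth, rootAxis, RExpr.cost, getS, scalarE, NExpr.cost]

theorem computes_logRule (G : ℝ → ℝ → ℝ) :
    Computes G logRule logGrowth logAxis where
  growth := by
    intro d M inp σ m
    simp [logGrowth, RExpr.val, val_getS, val_num, logRule]
  axis := by
    intro d M inp σ m h h7
    simp only [logAxis, RExpr.val, val_getS, val_num, h7, h, Nat.cast_one]
    rfl
  cost_le := by simp [logGrowth, logAxis, RExpr.cost, getS, num, scalarE, NExpr.cost]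

/-- The initialization is charged like one more point; `n + 1 ≤ 2n` turns `10000` into `20000`. -/
theorem ruleProg_steps_le_real {G : ℝ → ℝ → ℝ} {M d : ℕ} (hd : 1 ≤ d) {eγ ea : RExpr}
    (h : eγ.cost + ea.cost ≤ 100) (c₀ : Vec d) (r₀ : ℝ) (z : ℕ → Vec d) {n : ℕ} (hn : 1 ≤ n) :
    ((ruleProg eγ ea).steps G M c₀ r₀ z n : ℝ) ≤
      20000 * ((n : ℝ) * (d : ℝ) ^ 2 * (1 + Real.log d) ^ 0) := by
  have h1 : (ruleProg eγ ea).steps G M c₀ r₀ z n ≤ 20000 * (n * d ^ 2) := by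
    refine (ruleProg_steps_le hd h c₀ r₀ z n).trans ?_
    calc (n + 1) * (10000 * d ^ 2) ≤ (2 * n) * (10000 * d ^ 2) := by gcongr; omega
      _ = _ := by ring
  rw [pow_zero, mul_one]
  exact_mod_cast h1

end StreamingEllipsoid

theorem theorem1 :
    -- the constants, and the two programs, depend on nothing else
    ∃ (C : ℝ) (K k : ℕ) (P Q : StreamingEllipsoid.Prog), 0 < C ∧
      ∀ (d : ℕ), 1 ≤ d → ∀ (c₀ : StreamingEllipsoid.Vec d) (r₀ : ℝ), 0 < r₀ →
        ∀ z : ℕ → StreamingEllipsoid.Vec d,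
          -- the two-phase algorithm is monotone and computes the claimed rounding
          StreamingEllipsoid.Guarantee C c₀ r₀ z (StreamingEllipsoid.algOut c₀ r₀ z) ∧
          -- with the root `γ` as a subroutine, `P` computes exactly what the algorithm
          -- maintains, in memory `O(d²)` and time `Õ(n d²)`
          (∀ t : ℕ, P.out StreamingEllipsoid.gammaStar (K * d ^ 2) c₀ r₀ z t =
            StreamingEllipsoid.algOut c₀ r₀ z t) ∧
          (∀ n : ℕ, 1 ≤ n →
            (P.steps StreamingEllipsoid.gammaStar (K * d ^ 2) c₀ r₀ z n : ℝ) ≤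
              C * ((n : ℝ) * (d : ℝ) ^ 2 * (1 + Real.log d) ^ k)) ∧
          -- without any subroutine, `Q` has all the guarantees as well, in memory `O(d²)` and
          -- time `Õ(n d²)`
          StreamingEllipsoid.Guarantee C c₀ r₀ z
            (Q.out StreamingEllipsoid.noSubroutine (K * d ^ 2) c₀ r₀ z) ∧
          (∀ n : ℕ, 1 ≤ n →
            (Q.steps StreamingEllipsoid.noSubroutine (K * d ^ 2) c₀ r₀ z n : ℝ) ≤
              C * ((n : ℝ) * (d : ℝ) ^ 2 * (1 + Real.log d) ^ k)) := by
  -- `20000` is the step constant and exceeds the `200` of the approximation factor; `14 = 1 + 3 +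
  -- 10` bounds the memory since `d ≥ 1`; the exponent `0` means that no logarithmic factor occurs.
  refine ⟨20000, 14, 0,
    StreamingEllipsoid.ruleProg StreamingEllipsoid.rootGrowth StreamingEllipsoid.rootAxis,
    StreamingEllipsoid.ruleProg StreamingEllipsoid.logGrowth StreamingEllipsoid.logAxis,
    by norm_num, fun d hd c₀ r₀ hr z => ?_⟩
  have hM : d * d + 3 * d + 10 ≤ 14 * d ^ 2 := by nlinarith
  have hroot : (fun t => (StreamingEllipsoid.rootRule.state c₀ r₀ z t).out) =
      StreamingEllipsoid.algOut c₀ r₀ z := by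
    funext t
    rw [StreamingEllipsoid.rootRule_state, StreamingEllipsoid.algOut]
  have hP := StreamingEllipsoid.ruleProg_out hM StreamingEllipsoid.computes_rootRule
    StreamingEllipsoid.rootRule_isValid hd c₀ hr z
  have hQ := StreamingEllipsoid.ruleProg_out hM
    (StreamingEllipsoid.computes_logRule StreamingEllipsoid.noSubroutine)
    StreamingEllipsoid.logRule_isValid hd c₀ hr z
  refine ⟨?_, fun t => (hP t).trans (congrFun hroot t), fun n hn => ?_, ?_, fun n hn => ?_⟩
  · rw [← hroot]
    exact StreamingEllipsoid.rootRule_isValid.guarantee hd hr (by norm_num)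
  · exact StreamingEllipsoid.ruleProg_steps_le_real hd
      StreamingEllipsoid.computes_rootRule.cost_le c₀ r₀ z hn
  · rw [funext hQ]
    exact StreamingEllipsoid.logRule_isValid.guarantee hd hr (by norm_num)
  · exact StreamingEllipsoid.ruleProg_steps_le_real hd
      (StreamingEllipsoid.computes_logRule StreamingEllipsoid.noSubroutine).cost_le c₀ r₀ z hn
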